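/- Let $n\ge 1$. For $\varepsilon>0$ and real polynomials $p^{\pm}(x,y)=\sum_{0\le i+j\le n}a^{\pm}_{ij}x^iy^j$, $q^{\pm}(x,y)=\sum_{0\le i+j\le n}b^{\pm}_{ij}x^iy^j$, consider the planar piecewise smooth system $$(\dot x,\dot y)=\begin{cases}\big(-y+\varepsilon p^{+}(x,y),\ 1-x+\varepsilon q^{+}(x,y)\big), & x\ge 0,\\ \big(-y+\varepsilon p^{-}(x,y),\ x+\varepsilon q^{-}(x,y)\big), & x<0,\end{cases}$$ with solutions understood in the sense of Filippov. For $\varepsilon=0$ it is piecewise linear and Hamiltonian, with Hamiltonians $H^+=\frac12((x-1)^2-y^2)$ and $H^-=-\frac12(x^2+y^2)$; it has a center at the origin, and the closed orbits around the origin fill the region bounded by the compound homoclinic loop $$L_0=\{0\le x\le 1,\ (x-1)^2=y^2\}\cup\{x<0,\ x^2+y^2=1\}$$ through the saddle $(1,0)$. A closed orbit is a simple closed curve traced by a periodic solution. A limit cycle is a closed orbit $\Gamma$ such that (i) $\Gamma$ crosses the line $x=0$ transversally, that is, at each of its points on this line the first components of the left and the right vector field have the same nonzero sign; (ii) $\Gamma$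 meets this line in exactly two points $(0,y_1)$, $(0,y_2)$ with $y_1<0<y_2$ (so $\Gamma$ surrounds the origin); (iii) some neighborhood of $\Gamma$ contains no other closed orbit. For a compact set $S$, say that $k$ limit cycles can bifurcate from $S$ if for every neighborhood $U$ of $S$ there are $p^\pm,q^\pm$ as above and $\varepsilon_0>0$ such that for all $0<\varepsilon<\varepsilon_0$ the system has at least $k$ limit cycles contained in $U$. Let $N_{Hopf}(n)$ and $N_{homoc}(n)$ in $\{0,1,2,\dots\}\cup\{\infty\}$ be the supremum of the $k$ for which $k$ limit cycles can bifurcate from $\{(0,0)\}$ and from $L_0$, respectively. Then $$(1)\quad N_{Hopf}(n)\ \ge\ n+\Big[\frac{n+1}{2}\Big],\qquad (2)\quad N_{homoc}(n)\ \ge\ n+\Big[\frac{n+1}{2}\Big],$$ where $[\cdot]$ denotes the integer part. -/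

import Mathlib

namespace PiecewiseHam

noncomputable section

open Set Topology MeasureTheory

/-- The polynomial `∑_{0 ≤ i + j ≤ n} c i j * x ^ i * y ^ j`, with arbitrary real coefficients. -/
def poly (n : ℕ) (c : ℕ → ℕ → ℝ) (z : ℝ × ℝ) : ℝ :=
  ∑ l ∈ Finset.range (n + 1), ∑ ij ∈ Finset.HasAntidiagonal.antidiagonal l,
    c ij.1 ij.2 * z.1 ^ ij.1 * z.2 ^ ij.2

/-- The coefficients of the four perturbing polynomials
`p⁺ = ∑ a⁺ᵢⱼ xⁱ yʲ`, `q⁺ = ∑ b⁺ᵢⱼ xⁱ yʲ`, `p⁻ = ∑ a⁻ᵢⱼ xⁱ yʲ`, `q⁻ = ∑ b⁻ᵢⱼ xⁱ yʲ`. -/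
structure Coeffs where
  aPlus : ℕ → ℕ → ℝ
  bPlus : ℕ → ℕ → ℝ
  aMinus : ℕ → ℕ → ℝ
  bMinus : ℕ → ℕ → ℝ

/-- The right vector field `(-y + ε p⁺, 1 - x + ε q⁺)`; for `ε = 0` it is the Hamiltonian vector
field `(H_y, -H_x)` of `H⁺ = ((x - 1)² - y²) / 2`. -/
def rightField (n : ℕ) (c : Coeffs) (ε : ℝ) (z : ℝ × ℝ) : ℝ × ℝ :=
  (-z.2 + ε * poly n c.aPlus z, 1 - z.1 + ε * poly n c.bPlus z)

/-- The left vector field `(-y + ε p⁻, x + ε q⁻)`; for `ε = 0` it is the Hamiltonian vector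
field `(H_y, -H_x)` of `H⁻ = -(x² + y²) / 2`. -/
def leftField (n : ℕ) (c : Coeffs) (ε : ℝ) (z : ℝ × ℝ) : ℝ × ℝ :=
  (-z.2 + ε * poly n c.aMinus z, z.1 + ε * poly n c.bMinus z)

/-- The Filippov set-valued field of the planar system that is `R` for `x > 0` and `L` for
`x < 0`: on the switching line `x = 0` it is the segment between the two vectors. -/
def filippov (R L : ℝ × ℝ → ℝ × ℝ) (z : ℝ × ℝ) : Set (ℝ × ℝ) :=
  {v | (0 < z.1 ∧ v = R z) ∨ (z.1 < 0 ∧ v = L z) ∨ (z.1 = 0 ∧ v ∈ segment ℝ (L z) (R z))}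

/-- Solutions (in the sense of Filippov) on the whole time axis. -/
def IsSolution (R L : ℝ × ℝ → ℝ × ℝ) (γ : ℝ → ℝ × ℝ) : Prop :=
  (∀ s t : ℝ, AbsolutelyContinuousOnInterval γ s t) ∧
    ∀ᵐ t : ℝ, ∃ v ∈ filippov R L (γ t), HasDerivAt γ v t

/-- `Γ` is a closed orbit: the simple closed curve traced by a periodic solution. -/
def IsClosedOrbit (R L : ℝ × ℝ → ℝ × ℝ) (Γ : Set (ℝ × ℝ)) : Prop :=
  ∃ (γ : ℝ → ℝ × ℝ) (T : ℝ), 0 < T ∧ IsSolution R L γ ∧ Function.Periodic γ T ∧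
    InjOn γ (Ico 0 T) ∧ range γ = Γ

/-- `Γ` is a (crossing) limit cycle around the origin: a closed orbit which
* passes through the switching line wherever it meets it (both fields point strictly to the same
  side of the line there, so there is neither sliding nor tangency),
* meets the switching line in exactly two points, one on either side of the origin, so that it
  encloses the origin,
* is isolated among all closed orbits of the system, sliding ones included. -/
def IsLimitCycle (R L : ℝ × ℝ → ℝ × ℝ) (Γ : Set (ℝ × ℝ)) : Prop :=
  IsClosedOrbit R L Γ ∧
  (∀ z ∈ Γ, z.1 = 0 → 0 < (R z).1 * (L z).1) ∧
  (∃ y₁ y₂ : ℝ, y₁ < 0 ∧ 0 < y₂ ∧ Γ ∩ {z | z.1 = 0} = {(0, y₁), (0, y₂)}) ∧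
  ∃ U : Set (ℝ × ℝ), IsOpen U ∧ Γ ⊆ U ∧ ∀ Γ', IsClosedOrbit R L Γ' → Γ' ⊆ U → Γ' = Γ

/-- The limit cycles, lying in `U`, of the perturbed system. -/
def limitCyclesIn (n : ℕ) (c : Coeffs) (ε : ℝ) (U : Set (ℝ × ℝ)) : Set (Set (ℝ × ℝ)) :=
  {Γ | IsLimitCycle (rightField n c ε) (leftField n c ε) Γ ∧ Γ ⊆ U}

/-- The compound homoclinic loop through the saddle `(1, 0)` of the unperturbed system: the
level `H⁺ = 0` over `0 ≤ x ≤ 1` together with the level `H⁻ = -1/2` over `x < 0`. -/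
def homoclinicLoop : Set (ℝ × ℝ) :=
  {z | 0 ≤ z.1 ∧ z.1 ≤ 1 ∧ ((z.1 - 1) ^ 2 - z.2 ^ 2) / 2 = 0} ∪
    {z | z.1 < 0 ∧ -(z.1 ^ 2 + z.2 ^ 2) / 2 = -1 / 2}

/-- `k` limit cycles can bifurcate from the set `S`, with perturbations of degree `n`:
arbitrarily close to `S` there are, for suitable coefficients and all sufficiently small `ε > 0`,
at least `k` limit cycles. -/
def CanBifurcate (n : ℕ) (S : Set (ℝ × ℝ)) (k : ℕ) : Prop :=
  ∀ U ∈ 𝓝ˢ S, ∃ c : Coeffs, ∃ ε₀ : ℝ, 0 < ε₀ ∧ ∀ ε ∈ Ioo (0 : ℝ) ε₀,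
    (k : ℕ∞) ≤ (limitCyclesIn n c ε U).encard

/-- The maximal number of limit cycles in Hopf bifurcation near the origin. -/
def NHopf (n : ℕ) : ℕ∞ :=
  ⨆ (k : ℕ) (_ : CanBifurcate n {(0, 0)} k), (k : ℕ∞)

/-- The maximal number of limit cycles in homoclinic bifurcation near the compound loop. -/
def NHomoc (n : ℕ) : ℕ∞ :=
  ⨆ (k : ℕ) (_ : CanBifurcate n homoclinicLoop k), (k : ℕ∞)

end

end PiecewiseHam

/-!
Displacement functions turn limit cycles into zeros of the first-order Melnikov function
`M ρ`, where `(0, ρ)` with `0 < ρ < 1` lies on the unperturbed closed orbit. As the perturbing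
polynomials vary, `M` ranges over the functions `P ρ + T (1 - ρ ^ 2) * I ρ`, where `P` is an
arbitrary polynomial of degree at most `n`, `T` one of degree less than `⌊(n + 1) / 2⌋`, and `I` is
the integral of `√(1 - ρ ^ 2 + ρ ^ 2 * s ^ 2)` over `[-1, 1]`. Since `I` contains
`log ((1 + ρ) / (1 - ρ))`, which is not rational, these functions form a space of dimension
`n + 1 + ⌊(n + 1) / 2⌋` on every subinterval of `(0, 1)`, so some `M` has `n + ⌊(n + 1) / 2⌋` zeros
there; subtracting a constant that is a regular value makes them simple. A simple zero persists as
a hyperbolic fixed point of the return map, hence as a limit cycle that is isolated among all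
closed orbits. Subintervals near `ρ = 0` and near `ρ = 1` give the two bounds.
-/

namespace PiecewiseHam

open Set Filter Topology MeasureTheory Asymptotics

section UniformEstimates

theorem exists_eventually_norm_le_of_isCompact {E F : Type*} [NormedAddCommGroup E]
    [NormedAddCommGroup F] {K : Set ℝ} {f : ℝ × E → F} {x₀ : E} (hK : IsCompact K)
    (hf : ∀ s ∈ K, ContinuousAt f (s, x₀)) : ∃ C, ∀ᶠ x in 𝓝 x₀, ∀ s ∈ K, ‖f (s, x)‖ ≤ C := by
  obtain ⟨C, hC⟩ := hK.exists_bound_of_continuousOn (f := fun s => f (s, x₀)) fun s hs =>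
    ((hf s hs).comp (f := fun s => (s, x₀)) (by fun_prop)).continuousWithinAt
  refine ⟨C + 1, hK.eventually_forall_of_forall_eventually fun s hs => ?_⟩
  have hnorm := ((hf s hs).norm.tendsto.comp (continuous_swap.tendsto (x₀, s)))
  exact (hnorm.eventually_le_const ((hC s hs).trans_lt (lt_add_one C)))

variable {E F : Type*} [NormedAddCommGroup E] [NormedSpace ℝ E] [NormedAddCommGroup F]
  [NormedSpace ℝ F] {K : Set ℝ} {f : ℝ × E → F} {x₀ : E}

theorem isLittleO_sub_sub_fderiv_of_isCompact (hK : IsCompact K)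
    (hf : ∀ s ∈ K, ContDiffAt ℝ 1 f (s, x₀)) :
    (fun p : (E × E) × ℝ => f (p.2, p.1.1) - f (p.2, p.1.2)
      - fderiv ℝ f (p.2, x₀) (0, p.1.1 - p.1.2)) =o[𝓝 (x₀, x₀) ×ˢ 𝓟 K]
      fun p => p.1.1 - p.1.2 := by
  refine isLittleO_iff.2 fun c hc => eventually_prod_principal_iff.2 ?_
  refine hK.eventually_forall_of_forall_eventually fun s hs => ?_
  have hpair : Tendsto (fun q : (E × E) × ℝ => ((q.2, q.1.1), (q.2, q.1.2)))
      (𝓝 ((x₀, x₀), s)) (𝓝 ((s, x₀), (s, x₀))) :=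
    Continuous.tendsto (by fun_prop) _
  have hbase : Tendsto (fun q : (E × E) × ℝ => (q.2, x₀)) (𝓝 ((x₀, x₀), s)) (𝓝 (s, x₀)) :=
    Continuous.tendsto (by fun_prop) _
  have hderiv := ((hf s hs).continuousAt_fderiv one_ne_zero).tendsto.comp hbase
  filter_upwards [hpair.eventually
      (((hf s hs).hasStrictFDerivAt one_ne_zero).isLittleO.def (half_pos hc)),
    Metric.tendsto_nhds.1 hderiv (c / 2) (half_pos hc)] with q hq hq'
  rw [Function.comp_apply, dist_eq_norm] at hq'
  rw [Prod.mk_sub_mk, sub_self] at hq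
  have hnorm : ‖((0 : ℝ), q.1.1 - q.1.2)‖ = ‖q.1.1 - q.1.2‖ := by simp [Prod.norm_def]
  have hvar := (fderiv ℝ f (q.2, x₀) - fderiv ℝ f (s, x₀)).le_of_opNorm_le hq'.le
    (0, q.1.1 - q.1.2)
  rw [hnorm] at hq hvar
  calc _ = ‖(f (q.2, q.1.1) - f (q.2, q.1.2) - fderiv ℝ f (s, x₀) (0, q.1.1 - q.1.2))
        - (fderiv ℝ f (q.2, x₀) - fderiv ℝ f (s, x₀)) (0, q.1.1 - q.1.2)‖ := by
        rw [sub_apply, sub_sub_sub_cancel_right]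
    _ ≤ c / 2 * ‖q.1.1 - q.1.2‖ + c / 2 * ‖q.1.1 - q.1.2‖ := norm_sub_le_of_le hq hvar
    _ = c * ‖q.1.1 - q.1.2‖ := by ring

theorem isBigO_sub_of_isCompact (hK : IsCompact K) (hf : ∀ s ∈ K, ContDiffAt ℝ 1 f (s, x₀)) :
    (fun p : (E × E) × ℝ => f (p.2, p.1.1) - f (p.2, p.1.2)) =O[𝓝 (x₀, x₀) ×ˢ 𝓟 K]
      fun p => p.1.1 - p.1.2 := by
  have hcont : ContinuousOn (fun s => fderiv ℝ f (s, x₀)) K := fun s hs =>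
    (((hf s hs).continuousAt_fderiv one_ne_zero).comp (f := fun s => (s, x₀))
      (by fun_prop)).continuousWithinAt
  obtain ⟨C, hC⟩ := hK.exists_bound_of_continuousOn hcont
  have hlin : (fun p : (E × E) × ℝ => fderiv ℝ f (p.2, x₀) (0, p.1.1 - p.1.2))
      =O[𝓝 (x₀, x₀) ×ˢ 𝓟 K] fun p => p.1.1 - p.1.2 := by
    refine .of_bound C (eventually_prod_principal_iff.2 (.of_forall fun q s hs => ?_))
    simpa [Prod.norm_def] using (fderiv ℝ f (s, x₀)).le_of_opNorm_le (hC s hs) (0, q.1 - q.2)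
  exact ((isLittleO_sub_sub_fderiv_of_isCompact hK hf).isBigO.add hlin).congr_left fun p => by
    abel

theorem exists_lipschitzOnWith_of_isCompact (hK : IsCompact K)
    (hf : ∀ s ∈ K, ContDiffAt ℝ 1 f (s, x₀)) :
    ∃ C : NNReal, ∃ W ∈ 𝓝 x₀, ∀ s ∈ K, LipschitzOnWith C (fun x => f (s, x)) W := by
  obtain ⟨C, hC₀, hC⟩ := (isBigO_sub_of_isCompact hK hf).exists_nonneg
  rw [IsBigOWith, eventually_prod_principal_iff, nhds_prod_eq, eventually_prod_self_iff'] at hC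
  obtain ⟨W, hW, hlip⟩ := hC
  lift C to NNReal using hC₀
  exact ⟨C, W, hW, fun s hs => .of_dist_le_mul fun x hx y hy => by
    simpa [dist_eq_norm] using hlip x hx y hy s hs⟩

theorem eventually_forall_continuousAt_of_isCompact (hK : IsCompact K)
    (hf : ∀ s ∈ K, ContDiffAt ℝ 1 f (s, x₀)) :
    ∀ᶠ x in 𝓝 x₀, ∀ s ∈ K, ContinuousAt f (s, x) :=
  hK.eventually_forall_of_forall_eventually fun s hs =>
    (continuous_swap.tendsto (x₀, s)).eventually
      (((hf s hs).eventually (by simp)).mono fun _ h => h.continuousAt)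

end UniformEstimates

section Primitives

variable {ι E F : Type*} [NormedAddCommGroup E] [NormedSpace ℝ E] [NormedAddCommGroup F]
  {l : Filter ι} {a b : ℝ} {φ : ι → ℝ → E} {g : ι → F}

theorem isBigOWith_integral {C : ℝ} (hC : 0 ≤ C)
    (h : IsBigOWith C (l ×ˢ 𝓟 (Icc a b)) (fun p => φ p.1 p.2) fun p => g p.1) :
    IsBigOWith (C * (b - a)) (l ×ˢ 𝓟 (Icc a b)) (fun p => ∫ s in a..p.2, φ p.1 s)
      fun p => g p.1 := by
  rw [IsBigOWith, eventually_prod_principal_iff] at h ⊢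
  filter_upwards [h] with i hi t ht
  refine (intervalIntegral.norm_integral_le_of_norm_le_const (C := C * ‖g i‖) fun s hs => ?_).trans
    ?_
  · rw [uIoc_of_le ht.1] at hs
    exact hi s ⟨hs.1.le, hs.2.trans ht.2⟩
  · rw [abs_of_nonneg (sub_nonneg.2 ht.1), mul_right_comm]
    gcongr
    exact ht.2

theorem isBigO_integral
    (h : (fun p : ι × ℝ => φ p.1 p.2) =O[l ×ˢ 𝓟 (Icc a b)] fun p => g p.1) :
    (fun p : ι × ℝ => ∫ s in a..p.2, φ p.1 s) =O[l ×ˢ 𝓟 (Icc a b)] fun p => g p.1 :=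
  let ⟨_, hC, h⟩ := h.exists_nonneg
  (isBigOWith_integral hC h).isBigO

theorem isLittleO_integral (hab : a ≤ b)
    (h : (fun p : ι × ℝ => φ p.1 p.2) =o[l ×ˢ 𝓟 (Icc a b)] fun p => g p.1) :
    (fun i => ∫ s in a..b, φ i s) =o[l] g := by
  rw [isLittleO_iff_forall_isBigOWith]
  intro c hc
  have hpos : 0 < b - a + 1 := by linarith
  have hend : Tendsto (fun i => (i, b)) l (l ×ˢ 𝓟 (Icc a b)) :=
    tendsto_id.prodMk (tendsto_principal.2 (.of_forall fun _ => right_mem_Icc.2 hab))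
  refine ((isBigOWith_integral (by positivity)
    (h.forall_isBigOWith (div_pos hc hpos))).comp_tendsto hend).weaken ?_
  rw [div_mul_eq_mul_div, div_le_iff₀ hpos]
  gcongr
  linarith

end Primitives

theorem tendsto_sub_of_isBigO {X E : Type*} [NormedAddCommGroup X] [NormedAddCommGroup E]
    {g : X → ℝ → E} {z₀ : X} {S : Set ℝ}
    (hg : (fun p : (X × X) × ℝ => g p.1.1 p.2 - g p.1.2 p.2) =O[𝓝 (z₀, z₀) ×ˢ 𝓟 S]
      fun p => p.1.1 - p.1.2) :
    Tendsto (fun p : X × ℝ => g p.1 p.2 - g z₀ p.2) (𝓝 z₀ ×ˢ 𝓟 S) (𝓝 0) := by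
  have hpair : Tendsto (fun p : X × ℝ => ((p.1, z₀), p.2)) (𝓝 z₀ ×ˢ 𝓟 S)
      (𝓝 (z₀, z₀) ×ˢ 𝓟 S) :=
    (tendsto_fst.prodMk_nhds tendsto_const_nhds).prodMk tendsto_snd
  refine (hg.comp_tendsto hpair).trans_tendsto ?_
  simpa [Function.comp_def] using (tendsto_fst (f := 𝓝 z₀) (g := 𝓟 S)).sub_const z₀

section Averaging

variable {E : Type*} [NormedAddCommGroup E] [NormedSpace ℝ E] {f : ℝ × E × ℝ → E} {a b : ℝ}
  {r : E}

/-- `u z` is, for all `z = (ρ, e)` near `(r, 0)`, the solution of `u' = e f(s, u, e)` on `[a, b]`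
starting at `ρ`; the family is Lipschitz in `z`, uniformly in the time. -/
structure IsSmallFlow (f : ℝ × E × ℝ → E) (a b : ℝ) (r : E) (u : E × ℝ → ℝ → E) : Prop where
  initial : ∀ᶠ z in 𝓝 (r, 0), u z a = z.1
  hasDerivWithinAt : ∀ᶠ z in 𝓝 (r, 0), ∀ s ∈ Icc a b,
    HasDerivWithinAt (u z) (z.2 • f (s, u z s, z.2)) (Icc a b) s
  unperturbed : ∀ s ∈ Icc a b, u (r, 0) s = r
  isBigO : (fun p : ((E × ℝ) × E × ℝ) × ℝ => u p.1.1 p.2 - u p.1.2 p.2)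
    =O[𝓝 ((r, 0), (r, 0)) ×ˢ 𝓟 (Icc a b)] fun p => p.1.1 - p.1.2

theorem eq_of_hasDerivWithinAt_zero {g : ℝ → E}
    (hg : ∀ s ∈ Icc a b, HasDerivWithinAt g 0 (Icc a b) s) {s : ℝ} (hs : s ∈ Icc a b) :
    g s = g a :=
  constant_of_derivWithin_zero (fun t ht => (hg t ht).differentiableWithinAt)
    (fun t ht => (hg t (Ico_subset_Icc_self ht)).derivWithin
      (uniqueDiffOn_Icc (ht.1.trans_lt ht.2) t (Ico_subset_Icc_self ht))) s hs

/- The parameter becomes a second component of the state. Rescaling it by a large factor `M` makes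
the field small enough for the solutions to live on all of `[a, b]`. -/
theorem exists_isPicardLindelof_rescaled (hab : a ≤ b)
    (hf : ∀ s ∈ Icc a b, ContDiffAt ℝ 1 f (s, r, 0)) :
    ∃ M > 0, ∃ R > 0, ∃ C K : NNReal,
      IsPicardLindelof (fun s x => ((M⁻¹ * x.2) • f (s, x.1, M⁻¹ * x.2), (0 : ℝ)))
        (⟨a, left_mem_Icc.2 hab⟩ : Icc a b) (r, (0 : ℝ)) R (R / 2) C K := by
  obtain ⟨C, hC⟩ := exists_eventually_norm_le_of_isCompact isCompact_Icc fun s hs =>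
    (hf s hs).continuousAt
  have hC₀ : 0 ≤ C := (norm_nonneg _).trans (hC.self_of_nhds a (left_mem_Icc.2 hab))
  set M := 2 * (C * (b - a)) + 1 with hM
  have hM₀ : 0 < M := by have := mul_nonneg hC₀ (sub_nonneg.2 hab); positivity
  have hscale : ContDiff ℝ 1 fun q : ℝ × E × ℝ => (q.1, q.2.1, M⁻¹ * q.2.2) := by fun_prop
  have hsmooth : ∀ s ∈ Icc a b, ContDiffAt ℝ 1
      (fun q : ℝ × E × ℝ => ((M⁻¹ * q.2.2) • f (q.1, q.2.1, M⁻¹ * q.2.2), (0 : ℝ))) (s, r, 0) := by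
    intro s hs
    have hf' : ContDiffAt ℝ 1 f (s, r, M⁻¹ * 0) := by simpa using hf s hs
    exact (ContDiffAt.smul (by fun_prop) (hf'.comp (s, r, (0 : ℝ)) hscale.contDiffAt)).prodMk
      contDiffAt_const
  obtain ⟨K, W, hW, hlip⟩ := exists_lipschitzOnWith_of_isCompact isCompact_Icc hsmooth
  have hscale₂ : Tendsto (fun x : E × ℝ => (x.1, M⁻¹ * x.2)) (𝓝 (r, 0)) (𝓝 (r, 0)) :=
    Continuous.tendsto' (by fun_prop) _ _ (by simp)
  have hcont := eventually_forall_continuousAt_of_isCompact isCompact_Icc hsmooth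
  obtain ⟨R, hR, hball⟩ := Metric.nhds_basis_closedBall.eventually_iff.1
    ((hscale₂.eventually hC).and (hcont.and hW))
  lift R to NNReal using hR.le
  lift C to NNReal using hC₀
  refine ⟨M, hM₀, R, NNReal.coe_pos.1 hR, M.toNNReal⁻¹ * R * C, K, ?_, ?_, ?_, ?_⟩
  · exact fun s hs => (hlip s hs).mono fun x hx => (hball hx).2.2
  · exact fun x hx s hs => (((hball hx).2.1 s hs).comp (f := fun s => (s, x))
      (by fun_prop)).continuousWithinAt
  · intro s hs x hx
    have hx₂ : |x.2| ≤ R := by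
      simpa using (norm_snd_le _).trans (mem_closedBall_iff_norm.1 hx)
    have hfx := (hball hx).1 s hs
    simp only [Prod.norm_mk, norm_smul, norm_mul, norm_inv, norm_zero, Real.norm_eq_abs,
      abs_of_pos hM₀, NNReal.coe_mul, NNReal.coe_inv, Real.coe_toNNReal _ hM₀.le]
    refine max_le ?_ (by positivity)
    gcongr
  · simp only [sub_self, max_eq_left (sub_nonneg.2 hab), NNReal.coe_mul, NNReal.coe_inv,
      Real.coe_toNNReal _ hM₀.le, NNReal.coe_div, NNReal.coe_ofNat]
    rw [← div_eq_inv_mul, div_mul_eq_mul_div, div_mul_eq_mul_div, div_le_iff₀ hM₀, hM]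
    nlinarith

theorem exists_isSmallFlow [CompleteSpace E] (hab : a ≤ b)
    (hf : ∀ s ∈ Icc a b, ContDiffAt ℝ 1 f (s, r, 0)) : ∃ u, IsSmallFlow f a b r u := by
  obtain ⟨M, hM, R, hR, C, K, hPL⟩ := exists_isPicardLindelof_rescaled hab hf
  obtain ⟨α, hα, L, hL⟩ := hPL.exists_forall_mem_closedBall_eq_hasDerivWithinAt_lipschitzOnWith
  set B := Metric.closedBall (r, (0 : ℝ)) (R / 2 : NNReal)
  have hsnd : ∀ x ∈ B, ∀ s ∈ Icc a b, (α x s).2 = x.2 := fun x hx s hs => by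
    rw [eq_of_hasDerivWithinAt_zero (fun t ht => ((hα x hx).2 t ht).snd) hs, (hα x hx).1]
  have hfst : ∀ x ∈ B, ∀ s ∈ Icc a b, HasDerivWithinAt (fun t => (α x t).1)
      ((M⁻¹ * x.2) • f (s, (α x s).1, M⁻¹ * x.2)) (Icc a b) s := fun x hx s hs => by
    have := ((hα x hx).2 s hs).fst
    rwa [hsnd x hx s hs] at this
  let T : E × ℝ →L[ℝ] E × ℝ := (ContinuousLinearMap.fst ℝ E ℝ).prod
    (M • ContinuousLinearMap.snd ℝ E ℝ)
  have hB : ∀ᶠ z : E × ℝ in 𝓝 (r, 0), T z ∈ B :=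
    (T.continuous.tendsto' (r, (0 : ℝ)) (r, 0) (by simp [T])).eventually
      (Metric.closedBall_mem_nhds _ (NNReal.coe_pos.2 (half_pos hR)))
  have hmem : (r, (0 : ℝ)) ∈ B := Metric.mem_closedBall_self (NNReal.coe_nonneg _)
  refine ⟨fun z s => (α (T z) s).1, ⟨?_, ?_, fun s hs => ?_, .of_bound (L * ‖T‖) ?_⟩⟩
  · filter_upwards [hB] with z hz
    simp only [(hα _ hz).1]
    simp [T]
  · filter_upwards [hB] with z hz s hs
    simpa [T, hM.ne'] using hfst _ hz s hs
  · have hzero : ∀ t ∈ Icc a b, HasDerivWithinAt (fun t => (α (r, 0) t).1) 0 (Icc a b) t :=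
      fun t ht => by simpa using hfst _ hmem t ht
    simpa [(hα _ hmem).1, T] using eq_of_hasDerivWithinAt_zero hzero hs
  · rw [eventually_prod_principal_iff, nhds_prod_eq]
    filter_upwards [hB.prod_mk hB] with z hz s hs
    refine (norm_fst_le _).trans (((hL s hs).norm_sub_le hz.1 hz.2).trans ?_)
    rw [mul_assoc, ← map_sub]
    gcongr
    exact T.le_opNorm _

/-- For the solutions `u z` of `u' = e f(s, u, e)`, `z = (ρ, e)`, this is `(u z t - ρ) / e`,
extended smoothly across `e = 0`. -/
noncomputable def displacement (f : ℝ × E × ℝ → E) (u : E × ℝ → ℝ → E) (a t : ℝ) (z : E × ℝ) :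
    E :=
  ∫ s in a..t, f (s, u z s, z.2)

namespace IsSmallFlow

variable {u : E × ℝ → ℝ → E}

theorem tendsto (hu : IsSmallFlow f a b r u) :
    Tendsto (fun p : (E × ℝ) × ℝ => u p.1 p.2) (𝓝 (r, 0) ×ˢ 𝓟 (Icc a b)) (𝓝 r) := by
  rw [← tendsto_sub_nhds_zero_iff]
  refine (tendsto_sub_of_isBigO hu.isBigO).congr' ?_
  refine eventually_prod_principal_iff.2 (.of_forall fun z s hs => ?_)
  simp [hu.unperturbed s hs]

theorem tendsto_prodMk (hu : IsSmallFlow f a b r u) :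
    Tendsto (fun p : (E × ℝ) × ℝ => (u p.1 p.2, p.1.2)) (𝓝 (r, 0) ×ˢ 𝓟 (Icc a b))
      (𝓝 (r, 0)) :=
  hu.tendsto.prodMk_nhds ((continuous_snd.tendsto (r, (0 : ℝ))).comp tendsto_fst)

theorem isBigO_prodMk (hu : IsSmallFlow f a b r u) :
    (fun p : ((E × ℝ) × E × ℝ) × ℝ => (u p.1.1 p.2, p.1.1.2) - (u p.1.2 p.2, p.1.2.2))
      =O[𝓝 ((r, 0), (r, 0)) ×ˢ 𝓟 (Icc a b)] fun p => p.1.1 - p.1.2 :=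
  hu.isBigO.prod_left (.of_bound 1 (.of_forall fun p => by
    simpa using norm_snd_le (p.1.1 - p.1.2)))

theorem tendsto_pair (hu : IsSmallFlow f a b r u) :
    Tendsto (fun p : ((E × ℝ) × E × ℝ) × ℝ =>
        (((u p.1.1 p.2, p.1.1.2), (u p.1.2 p.2, p.1.2.2)), p.2))
      (𝓝 ((r, 0), (r, 0)) ×ˢ 𝓟 (Icc a b)) (𝓝 ((r, 0), (r, 0)) ×ˢ 𝓟 (Icc a b)) := by
  have hfst : Tendsto (fun p : ((E × ℝ) × E × ℝ) × ℝ => (p.1.1, p.2))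
      (𝓝 ((r, 0), (r, 0)) ×ˢ 𝓟 (Icc a b)) (𝓝 (r, 0) ×ˢ 𝓟 (Icc a b)) :=
    (continuous_fst.tendsto (((r, 0), (r, 0)) : (E × ℝ) × E × ℝ)).prodMap tendsto_id
  have hsnd : Tendsto (fun p : ((E × ℝ) × E × ℝ) × ℝ => (p.1.2, p.2))
      (𝓝 ((r, 0), (r, 0)) ×ˢ 𝓟 (Icc a b)) (𝓝 (r, 0) ×ˢ 𝓟 (Icc a b)) :=
    (continuous_snd.tendsto (((r, 0), (r, 0)) : (E × ℝ) × E × ℝ)).prodMap tendsto_id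
  exact ((hu.tendsto_prodMk.comp hfst).prodMk_nhds (hu.tendsto_prodMk.comp hsnd)).prodMk
    tendsto_snd

theorem continuousOn_field (hu : IsSmallFlow f a b r u)
    (hf : ∀ s ∈ Icc a b, ContDiffAt ℝ 1 f (s, r, 0)) :
    ∀ᶠ z in 𝓝 (r, 0), ContinuousOn (fun s => f (s, u z s, z.2)) (Icc a b) := by
  have hcont := hu.tendsto_prodMk.eventually
    (eventually_forall_continuousAt_of_isCompact isCompact_Icc hf)
  filter_upwards [eventually_prod_principal_iff.1 hcont, hu.hasDerivWithinAt] with z hz hdz s hs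
  exact (hz s hs s hs).comp_continuousWithinAt (f := fun s => (s, u z s, z.2))
    (continuousWithinAt_id.prodMk ((hdz s hs).continuousWithinAt.prodMk continuousWithinAt_const))

theorem intervalIntegrable_field (hu : IsSmallFlow f a b r u)
    (hf : ∀ s ∈ Icc a b, ContDiffAt ℝ 1 f (s, r, 0)) :
    ∀ᶠ z in 𝓝 (r, 0), ∀ t ∈ Icc a b,
      IntervalIntegrable (fun s => f (s, u z s, z.2)) volume a t := by
  filter_upwards [hu.continuousOn_field hf] with z hz t ht
  refine (hz.mono ?_).intervalIntegrable
  rw [uIcc_of_le ht.1]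
  exact Icc_subset_Icc_right ht.2

theorem eq_add_smul_displacement [CompleteSpace E] (hu : IsSmallFlow f a b r u)
    (hf : ∀ s ∈ Icc a b, ContDiffAt ℝ 1 f (s, r, 0)) :
    ∀ᶠ z in 𝓝 (r, 0), ∀ t ∈ Icc a b, u z t = z.1 + z.2 • displacement f u a t z := by
  filter_upwards [hu.initial, hu.hasDerivWithinAt, hu.intervalIntegrable_field hf]
    with z hz₀ hz hint t ht
  have hFTC := intervalIntegral.integral_eq_sub_of_hasDeriv_right_of_le ht.1
    (fun s hs => ((hz s ⟨hs.1, hs.2.trans ht.2⟩).continuousWithinAt.mono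
      (Icc_subset_Icc_right ht.2)))
    (fun s hs => (hz s ⟨hs.1.le, hs.2.le.trans ht.2⟩).mono_of_mem_nhdsWithin
      (Icc_mem_nhdsGT_of_mem ⟨hs.1.le, hs.2.trans_le ht.2⟩))
    ((hint t ht).smul z.2)
  rw [intervalIntegral.integral_smul, hz₀] at hFTC
  rw [displacement, hFTC, add_sub_cancel]

theorem isLittleO_field (hu : IsSmallFlow f a b r u)
    (hf : ∀ s ∈ Icc a b, ContDiffAt ℝ 1 f (s, r, 0)) :
    (fun p : ((E × ℝ) × E × ℝ) × ℝ =>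
        f (p.2, u p.1.1 p.2, p.1.1.2) - f (p.2, u p.1.2 p.2, p.1.2.2)
          - fderiv ℝ f (p.2, r, 0) (0, (u p.1.1 p.2, p.1.1.2) - (u p.1.2 p.2, p.1.2.2)))
      =o[𝓝 ((r, 0), (r, 0)) ×ˢ 𝓟 (Icc a b)] fun p => p.1.1 - p.1.2 :=
  ((isLittleO_sub_sub_fderiv_of_isCompact isCompact_Icc hf).comp_tendsto
    hu.tendsto_pair).trans_isBigO hu.isBigO_prodMk

theorem isBigO_displacement (hu : IsSmallFlow f a b r u)
    (hf : ∀ s ∈ Icc a b, ContDiffAt ℝ 1 f (s, r, 0)) :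
    (fun p : ((E × ℝ) × E × ℝ) × ℝ =>
        displacement f u a p.2 p.1.1 - displacement f u a p.2 p.1.2)
      =O[𝓝 ((r, 0), (r, 0)) ×ˢ 𝓟 (Icc a b)] fun p => p.1.1 - p.1.2 := by
  have hfield := ((isBigO_sub_of_isCompact isCompact_Icc hf).comp_tendsto
    hu.tendsto_pair).trans hu.isBigO_prodMk
  refine (isBigO_integral (φ := fun z s => f (s, u z.1 s, z.1.2) - f (s, u z.2 s, z.2.2))
    (g := fun z => z.1 - z.2) hfield).congr' ?_ .rfl
  have hint := hu.intervalIntegrable_field hf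
  rw [EventuallyEq, eventually_prod_principal_iff, nhds_prod_eq]
  filter_upwards [hint.prod_mk hint] with z hz t ht
  exact intervalIntegral.integral_sub (hz.1 t ht) (hz.2 t ht)

theorem tendsto_displacement_sub (hu : IsSmallFlow f a b r u)
    (hf : ∀ s ∈ Icc a b, ContDiffAt ℝ 1 f (s, r, 0)) :
    Tendsto (fun p : (E × ℝ) × ℝ => displacement f u a p.2 p.1 - displacement f u a p.2 (r, 0))
      (𝓝 (r, 0) ×ˢ 𝓟 (Icc a b)) (𝓝 0) :=
  tendsto_sub_of_isBigO (g := fun z t => displacement f u a t z) (hu.isBigO_displacement hf)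

theorem isLittleO_sub_sub [CompleteSpace E] (hu : IsSmallFlow f a b r u)
    (hf : ∀ s ∈ Icc a b, ContDiffAt ℝ 1 f (s, r, 0)) :
    (fun p : ((E × ℝ) × E × ℝ) × ℝ => u p.1.1 p.2 - u p.1.2 p.2
        - ((p.1.1 - p.1.2).1 + (p.1.1 - p.1.2).2 • displacement f u a p.2 (r, 0)))
      =o[𝓝 ((r, 0), (r, 0)) ×ˢ 𝓟 (Icc a b)] fun p => p.1.1 - p.1.2 := by
  have hparam : Tendsto (fun p : ((E × ℝ) × E × ℝ) × ℝ => p.1.1.2)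
      (𝓝 ((r, 0), (r, 0)) ×ˢ 𝓟 (Icc a b)) (𝓝 0) :=
    ((continuous_snd.comp continuous_fst).tendsto
      (((r, 0), (r, 0)) : (E × ℝ) × E × ℝ)).comp tendsto_fst
  have hsnd : Tendsto (fun p : ((E × ℝ) × E × ℝ) × ℝ => (p.1.2, p.2))
      (𝓝 ((r, 0), (r, 0)) ×ˢ 𝓟 (Icc a b)) (𝓝 (r, 0) ×ˢ 𝓟 (Icc a b)) :=
    (continuous_snd.tendsto (((r, 0), (r, 0)) : (E × ℝ) × E × ℝ)).prodMap tendsto_id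
  have hstate := ((isLittleO_one_iff ℝ).2 hparam).smul_isBigO (hu.isBigO_displacement hf)
  have hscale : (fun p : ((E × ℝ) × E × ℝ) × ℝ => (p.1.1 - p.1.2).2)
      =O[𝓝 ((r, 0), (r, 0)) ×ˢ 𝓟 (Icc a b)] fun p => ‖p.1.1 - p.1.2‖ :=
    .of_bound 1 (.of_forall fun p => by simpa using norm_snd_le (p.1.1 - p.1.2))
  have hslope := hscale.smul_isLittleO
    ((isLittleO_one_iff ℝ).2 ((hu.tendsto_displacement_sub hf).comp hsnd))
  simp only [smul_eq_mul, mul_one] at hslope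
  refine ((hstate.congr_right fun p => one_smul ℝ _).add hslope.of_norm_right).congr' ?_ .rfl
  have heq := hu.eq_add_smul_displacement hf
  rw [EventuallyEq, eventually_prod_principal_iff, nhds_prod_eq]
  filter_upwards [heq.prod_mk heq] with z hz t ht
  rw [hz.1 t ht, hz.2 t ht]
  simp only [Function.comp_apply, Prod.fst_sub, Prod.snd_sub]
  module

/-- The derivative of `z ↦ f (s, u z s, z.2)` at `(r, 0)`, where `c` is the displacement of the
unperturbed flow at time `s`. -/
noncomputable def fieldDeriv (f : ℝ × E × ℝ → E) (r c : E) (s : ℝ) : E × ℝ →L[ℝ] E :=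
  (fderiv ℝ f (s, r, 0)).comp (.inr ℝ ℝ (E × ℝ))
    + (ContinuousLinearMap.snd ℝ E ℝ).smulRight (fderiv ℝ f (s, r, 0) (0, c, 0))

theorem continuousOn_fderiv (hf : ∀ s ∈ Icc a b, ContDiffAt ℝ 1 f (s, r, 0)) :
    ContinuousOn (fun s => fderiv ℝ f (s, r, 0)) (Icc a b) := fun s hs =>
  (((hf s hs).continuousAt_fderiv one_ne_zero).comp (f := fun s => (s, r, (0 : ℝ)))
    (by fun_prop)).continuousWithinAt

theorem continuousOn_fieldDeriv (hab : a ≤ b) (hu : IsSmallFlow f a b r u)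
    (hf : ∀ s ∈ Icc a b, ContDiffAt ℝ 1 f (s, r, 0)) :
    ContinuousOn (fun s => fieldDeriv f r (displacement f u a s (r, 0)) s) (Icc a b) := by
  have hdisp : ContinuousOn (fun s => displacement f u a s (r, 0)) (Icc a b) := by
    have hint := (hu.intervalIntegrable_field hf).self_of_nhds b (right_mem_Icc.2 hab)
    rw [intervalIntegrable_iff_integrableOn_Icc_of_le hab, ← uIcc_of_le hab] at hint
    rw [← uIcc_of_le hab]
    exact intervalIntegral.continuousOn_primitive_interval hint
  have hderiv := continuousOn_fderiv hf
  exact (hderiv.clm_comp continuousOn_const).add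
    ((ContinuousLinearMap.smulRightL ℝ (E × ℝ) E (.snd ℝ E ℝ)).continuous.comp_continuousOn
      (hderiv.clm_apply (continuousOn_const.prodMk (hdisp.prodMk continuousOn_const))))

theorem isLittleO_fieldDeriv [CompleteSpace E] (hu : IsSmallFlow f a b r u)
    (hf : ∀ s ∈ Icc a b, ContDiffAt ℝ 1 f (s, r, 0)) :
    (fun p : ((E × ℝ) × E × ℝ) × ℝ =>
        f (p.2, u p.1.1 p.2, p.1.1.2) - f (p.2, u p.1.2 p.2, p.1.2.2)
          - fieldDeriv f r (displacement f u a p.2 (r, 0)) p.2 (p.1.1 - p.1.2))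
      =o[𝓝 ((r, 0), (r, 0)) ×ˢ 𝓟 (Icc a b)] fun p => p.1.1 - p.1.2 := by
  obtain ⟨C, hC⟩ := isCompact_Icc.exists_bound_of_continuousOn (continuousOn_fderiv hf)
  have hlin : (fun p : ((E × ℝ) × E × ℝ) × ℝ => fderiv ℝ f (p.2, r, 0)
      (0, u p.1.1 p.2 - u p.1.2 p.2
        - ((p.1.1 - p.1.2).1 + (p.1.1 - p.1.2).2 • displacement f u a p.2 (r, 0)), 0))
      =o[𝓝 ((r, 0), (r, 0)) ×ˢ 𝓟 (Icc a b)] fun p => p.1.1 - p.1.2 := by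
    refine IsBigO.trans_isLittleO (.of_bound C ?_) (hu.isLittleO_sub_sub hf)
    refine eventually_prod_principal_iff.2 (.of_forall fun z s hs => ?_)
    simpa using (fderiv ℝ f (s, r, 0)).le_of_opNorm_le (hC s hs) (0, u z.1 s - u z.2 s
      - ((z.1 - z.2).1 + (z.1 - z.2).2 • displacement f u a s (r, 0)), 0)
  refine ((hu.isLittleO_field hf).add hlin).congr_left fun p => ?_
  simp only [fieldDeriv, add_apply, ContinuousLinearMap.comp_apply, ContinuousLinearMap.inr_apply,
    ContinuousLinearMap.smulRight_apply, ContinuousLinearMap.coe_snd', ← map_smul]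
  rw [sub_add, sub_right_inj, ← map_sub, ← map_add]
  congr 1
  ext <;> simp

theorem exists_hasStrictFDerivAt_displacement [CompleteSpace E] (hab : a ≤ b)
    (hu : IsSmallFlow f a b r u) (hf : ∀ s ∈ Icc a b, ContDiffAt ℝ 1 f (s, r, 0)) :
    ∃ d' : E × ℝ →L[ℝ] E, HasStrictFDerivAt (displacement f u a b) d' (r, 0) := by
  have hcont := hu.continuousOn_fieldDeriv hab hf
  rw [← uIcc_of_le hab] at hcont
  refine ⟨∫ s in a..b, fieldDeriv f r (displacement f u a s (r, 0)) s, .of_isLittleO ?_⟩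
  refine (isLittleO_integral (φ := fun z s => f (s, u z.1 s, z.1.2) - f (s, u z.2 s, z.2.2)
    - fieldDeriv f r (displacement f u a s (r, 0)) s (z.1 - z.2)) (g := fun z => z.1 - z.2) hab
    (hu.isLittleO_fieldDeriv hf)).congr' ?_ .rfl
  have hint := hu.intervalIntegrable_field hf
  rw [EventuallyEq, nhds_prod_eq]
  filter_upwards [hint.prod_mk hint] with z hz
  have hz₁ := hz.1 b (right_mem_Icc.2 hab)
  have hz₂ := hz.2 b (right_mem_Icc.2 hab)
  rw [intervalIntegral.integral_sub (hz₁.sub hz₂)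
      (hcont.clm_apply continuousOn_const).intervalIntegrable,
    intervalIntegral.integral_sub hz₁ hz₂,
    ContinuousLinearMap.intervalIntegral_apply hcont.intervalIntegrable]
  rfl

theorem displacement_zero_eventuallyEq (hu : IsSmallFlow f a b r u) (hab : a ≤ b) :
    (fun ρ => displacement f u a b (ρ, 0)) =ᶠ[𝓝 r] fun ρ => ∫ s in a..b, f (s, ρ, 0) := by
  have hslice : Tendsto (fun ρ : E => (ρ, (0 : ℝ))) (𝓝 r) (𝓝 (r, 0)) :=
    Continuous.tendsto (by fun_prop) _
  filter_upwards [hslice.eventually hu.initial, hslice.eventually hu.hasDerivWithinAt]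
    with ρ hρ hdρ
  refine intervalIntegral.integral_congr fun s hs => ?_
  rw [uIcc_of_le hab] at hs
  have hconst : ∀ t ∈ Icc a b, HasDerivWithinAt (u (ρ, 0)) 0 (Icc a b) t := fun t ht => by
    simpa using hdρ t ht
  rw [eq_of_hasDerivWithinAt_zero hconst hs, hρ]

end IsSmallFlow

end Averaging

section TimeChange

variable {a b c : ℝ} {g : ℝ → ℝ}

theorem exists_orderIso_hasDerivAt (hg : Continuous g) (hc : 0 < c) (hcg : ∀ s, c ≤ g s) (a : ℝ) :
    ∃ τ : ℝ ≃o ℝ, τ a = 0 ∧ ∀ s, HasDerivAt τ (g s) s := by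
  set τ : ℝ → ℝ := fun s => ∫ x in a..s, g x
  have hτ : ∀ s, HasDerivAt τ (g s) s := fun s => (hg.integral_hasStrictDerivAt a s).hasDerivAt
  have hmono : StrictMono τ := strictMono_of_hasDerivAt_pos hτ fun s => hc.trans_le (hcg s)
  have hgrowth : Monotone fun s => τ s - c * s :=
    monotone_of_hasDerivAt_nonneg (f' := fun s => g s - c)
      (fun s => by simpa using (hτ s).fun_sub ((hasDerivAt_id' s).const_mul c))
      fun s => sub_nonneg.2 (hcg s)
  have htop : Tendsto τ atTop atTop := by
    simpa using tendsto_atTop_add_left_of_le' atTop _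
      ((eventually_ge_atTop 0).mono fun s hs => hgrowth hs) (tendsto_id.const_mul_atTop hc)
  have hbot : Tendsto τ atBot atBot := by
    simpa using tendsto_atBot_add_left_of_ge' atBot _
      ((eventually_le_atBot 0).mono fun s hs => hgrowth hs) (tendsto_id.const_mul_atBot hc)
  have hcont : Continuous τ := continuous_iff_continuousAt.2 fun s => (hτ s).continuousAt
  exact ⟨hmono.orderIsoOfSurjective τ (hcont.surjective htop hbot),
    intervalIntegral.integral_same, hτ⟩

theorem exists_timeChange (hab : a ≤ b) (hg : ContinuousOn g (Icc a b))
    (hpos : ∀ s ∈ Icc a b, 0 < g s) :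
    ∃ θ : ℝ ≃o ℝ, θ 0 = a ∧ ∀ t, θ t ∈ Icc a b → HasDerivAt θ (g (θ t))⁻¹ t := by
  obtain ⟨s₀, hs₀, hmin⟩ := isCompact_Icc.exists_isMinOn (nonempty_Icc.2 hab) hg
  obtain ⟨τ, hτa, hτ⟩ := exists_orderIso_hasDerivAt
    (g := IccExtend hab ((Icc a b).domRestrict g)) hg.domRestrict.Icc_extend' (hpos s₀ hs₀)
    (fun s => hmin (projIcc a b hab s).2) a
  refine ⟨τ.symm, by rw [← hτa, τ.symm_apply_apply], fun t ht => ?_⟩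
  have hderiv := hτ (τ.symm t)
  rw [IccExtend_of_mem hab _ ht] at hderiv
  exact .of_local_left_inverse τ.symm.continuous.continuousAt hderiv (hpos _ ht).ne'
    (.of_forall τ.apply_symm_apply)

end TimeChange

/-- `ζ` is, on `[0, T]`, an integral curve of `X` from `z₀` to `z₁` that lies strictly on the side
`σ * x < 0` of the switching line in between. -/
structure IsArc (X : ℝ × ℝ → ℝ × ℝ) (σ : ℝ) (z₀ z₁ : ℝ × ℝ) (T : ℝ) (ζ : ℝ → ℝ × ℝ) : Prop where
  pos : 0 < T
  source : ζ 0 = z₀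
  target : ζ T = z₁
  hasDerivWithinAt : ∀ t ∈ Icc 0 T, HasDerivWithinAt ζ (X (ζ t)) (Icc 0 T) t
  side : ∀ t ∈ Ioo 0 T, σ * (ζ t).1 < 0

/-- For `(ρ, e)` near `(r, 0)`, the field `X e` has an arc in `V` from `(0, σ ρ)` to
`(0, -σ (ρ + e d(ρ, e)))`, with a displacement `d` that is strictly differentiable at `(r, 0)` and
equals `I` for `e = 0`. -/
def IsHalfMap (X : ℝ → ℝ × ℝ → ℝ × ℝ) (σ r : ℝ) (I : ℝ → ℝ) (V : Set (ℝ × ℝ)) : Prop :=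
  ∃ d : ℝ × ℝ → ℝ, (∃ d' : ℝ × ℝ →L[ℝ] ℝ, HasStrictFDerivAt d d' (r, 0)) ∧
    (fun ρ => d (ρ, 0)) =ᶠ[𝓝 r] I ∧ ∀ᶠ z in 𝓝 (r, 0), ∃ T ζ,
      IsArc (X z.2) σ (0, σ * z.1) (0, -(σ * (z.1 + z.2 * d z))) T ζ ∧ MapsTo ζ (Icc 0 T) V

/-- The field `X₀` perturbed by `e p` in its first component. -/
def perturb (X₀ : ℝ × ℝ → ℝ × ℝ) (p : ℝ × ℝ → ℝ) (e : ℝ) (z : ℝ × ℝ) : ℝ × ℝ :=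
  X₀ z + e • (p z, 0)

/-- The unperturbed field of the left half plane, with a center at the origin. -/
def leftCenter (z : ℝ × ℝ) : ℝ × ℝ := (-z.2, z.1)

/-- The unperturbed field of the right half plane, with a saddle at `(1, 0)`. -/
def rightSaddle (z : ℝ × ℝ) : ℝ × ℝ := (-z.2, 1 - z.1)

/-- Coordinates `(s, ρ)` whose lines `ρ = const ∈ J` are arcs of `X₀` over `s ∈ [a, b]`, run through
with the time density `ω`. The last identity decomposes the direction `(1, 0)` of the perturbations
along the coordinates. -/
structure IsArcChart (X₀ : ℝ × ℝ → ℝ × ℝ) (σ a b : ℝ) (J : Set ℝ) (α : ℝ → ℝ) (β ω : ℝ → ℝ → ℝ)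
    (Φ : ℝ → ℝ → ℝ × ℝ) : Prop where
  source : ∀ ρ ∈ J, Φ a ρ = (0, σ * ρ)
  target : ∀ ρ ∈ J, Φ b ρ = (0, -(σ * ρ))
  side : ∀ s ∈ Ioo a b, ∀ ρ ∈ J, σ * (Φ s ρ).1 < 0
  contDiff_slope : ContDiff ℝ 1 α
  contDiffAt_slowing_coeff : ∀ s, ∀ ρ ∈ J, ContDiffAt ℝ 1 (fun z : ℝ × ℝ => β z.1 z.2) (s, ρ)
  continuousAt : ∀ s, ∀ ρ ∈ J, ContinuousAt (fun z : ℝ × ℝ => ω z.1 z.2) (s, ρ)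
  density_pos : ∀ s, ∀ ρ ∈ J, 0 < ω s ρ
  contDiffAt : ∀ s, ∀ ρ ∈ J, ContDiffAt ℝ 1 (fun z : ℝ × ℝ => Φ z.1 z.2) (s, ρ)
  deriv_fst : ∀ s, ∀ ρ ∈ J, deriv (fun s => Φ s ρ) s = ω s ρ • X₀ (Φ s ρ)
  deriv_snd : ∀ s, ∀ ρ ∈ J, α s • deriv (Φ s) ρ = ω s ρ • ((1, 0) + β s ρ • X₀ (Φ s ρ))

/-- Writing an orbit of `X₀ + e (p, 0)` as `Φ s (u s)` in an arc chart `Φ`, time is run through with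
the density `ω / slowing`, and `u` satisfies `u' = e * levelSlope`. -/
def slowing (p : ℝ × ℝ → ℝ) (β : ℝ → ℝ → ℝ) (Φ : ℝ → ℝ → ℝ × ℝ) (q : ℝ × ℝ × ℝ) : ℝ :=
  1 - q.2.2 * (β q.1 q.2.1 * p (Φ q.1 q.2.1))

/-- The slope of the level function `u` along a perturbed orbit, divided by `e`; see `slowing`. -/
noncomputable def levelSlope (p : ℝ × ℝ → ℝ) (α : ℝ → ℝ) (β : ℝ → ℝ → ℝ) (Φ : ℝ → ℝ → ℝ × ℝ)
    (q : ℝ × ℝ × ℝ) : ℝ :=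
  α q.1 * p (Φ q.1 q.2.1) / slowing p β Φ q

namespace IsArcChart

variable {X₀ : ℝ × ℝ → ℝ × ℝ} {σ a b : ℝ} {J : Set ℝ} {α : ℝ → ℝ} {β ω : ℝ → ℝ → ℝ}
  {Φ : ℝ → ℝ → ℝ × ℝ} {p : ℝ × ℝ → ℝ} {r : ℝ}

theorem contDiffAt_comp (h : IsArcChart X₀ σ a b J α β ω Φ) (hp : ContDiff ℝ 1 p) {q : ℝ × ℝ × ℝ}
    (hq : q.2.1 ∈ J) : ContDiffAt ℝ 1 (fun q : ℝ × ℝ × ℝ => p (Φ q.1 q.2.1)) q :=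
  hp.contDiffAt.comp q ((h.contDiffAt q.1 q.2.1 hq).comp
    (f := fun q : ℝ × ℝ × ℝ => (q.1, q.2.1)) q (by fun_prop))

theorem contDiffAt_slowing (h : IsArcChart X₀ σ a b J α β ω Φ) (hp : ContDiff ℝ 1 p)
    {q : ℝ × ℝ × ℝ} (hq : q.2.1 ∈ J) : ContDiffAt ℝ 1 (slowing p β Φ) q :=
  contDiffAt_const.sub ((by fun_prop : ContDiffAt ℝ 1 (fun q : ℝ × ℝ × ℝ => q.2.2) q).mul
    (((h.contDiffAt_slowing_coeff q.1 q.2.1 hq).comp (f := fun q : ℝ × ℝ × ℝ => (q.1, q.2.1)) q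
      (by fun_prop)).mul (h.contDiffAt_comp hp hq)))

theorem contDiffAt_levelSlope (h : IsArcChart X₀ σ a b J α β ω Φ) (hp : ContDiff ℝ 1 p)
    (hr : r ∈ J) (s : ℝ) : ContDiffAt ℝ 1 (levelSlope p α β Φ) (s, r, 0) :=
  ((h.contDiff_slope.contDiffAt.comp (s, r, (0 : ℝ)) contDiffAt_fst).mul
    (h.contDiffAt_comp hp hr)).div (h.contDiffAt_slowing hp hr) (by simp [slowing])

theorem hasDerivWithinAt (h : IsArcChart X₀ σ a b J α β ω Φ) {u : ℝ → ℝ} {S : Set ℝ} {s e : ℝ}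
    (hs : u s ∈ J) (hpos : 0 < slowing p β Φ (s, u s, e))
    (hu : HasDerivWithinAt u (e • levelSlope p α β Φ (s, u s, e)) S s) :
    HasDerivWithinAt (fun t => Φ t (u t)) ((ω s (u s) / slowing p β Φ (s, u s, e)) •
      (X₀ (Φ s (u s)) + e • (p (Φ s (u s)), 0))) S s := by
  have hΦ := ((h.contDiffAt s (u s) hs).differentiableAt one_ne_zero).hasFDerivAt
  refine (hΦ.comp_hasDerivWithinAt s ((hasDerivWithinAt_id s S).prodMk hu)).congr_deriv ?_
  set G := p (Φ s (u s)) with hG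
  set k := slowing p β Φ (s, u s, e) with hk
  have hsplit : ((1 : ℝ), e • levelSlope p α β Φ (s, u s, e))
      = (1, 0) + (e * (G / k)) • α s • ((0 : ℝ), (1 : ℝ)) := by
    ext
    · simp
    · simp [levelSlope, ← hG, ← hk]
      ring
  have hpush : (G, (0 : ℝ)) = G • ((1 : ℝ), (0 : ℝ)) := by simp
  have hk' : k = 1 - e * (β s (u s) * G) := rfl
  have hfst := (hΦ.comp_hasDerivAt s ((hasDerivAt_id s).prodMk (hasDerivAt_const s (u s)))).deriv
  have hsnd := (hΦ.comp_hasDerivAt (u s) ((hasDerivAt_const (u s) s).prodMk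
    (hasDerivAt_id (u s)))).deriv
  rw [hsplit, map_add, map_smul, map_smul, ← hfst, ← hsnd]
  simp only [Function.comp_def, id]
  rw [h.deriv_fst s _ hs, h.deriv_snd s _ hs, hpush]
  match_scalars
  · field_simp
    linear_combination ω s (u s) * hk'
  · field_simp

theorem eventually_forall_mem (h : IsArcChart X₀ σ a b J α β ω Φ) (hp : ContDiff ℝ 1 p)
    (hJ : J ∈ 𝓝 r) : ∀ᶠ x : ℝ × ℝ in 𝓝 (r, 0), ∀ s ∈ Icc a b,
      x.1 ∈ J ∧ 0 < slowing p β Φ (s, x.1, x.2) := by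
  refine isCompact_Icc.eventually_forall_of_forall_eventually fun s _ => ?_
  have hslow := (h.contDiffAt_slowing hp (q := (s, r, 0)) (mem_of_mem_nhds hJ)).continuousAt
  have hpos : 0 < slowing p β Φ (s, r, 0) := by simp [slowing]
  exact ((Continuous.tendsto' (by fun_prop) ((r, (0 : ℝ)), s) r rfl).eventually hJ).and
    ((continuous_swap.tendsto ((r, (0 : ℝ)), s)).eventually (hslow.eventually_const_lt hpos))

theorem exists_isArc (h : IsArcChart X₀ σ a b J α β ω Φ) (hab : a < b) (hp : ContDiff ℝ 1 p)
    {V : Set (ℝ × ℝ)} {u : ℝ → ℝ} {e : ℝ}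
    (hu : ∀ s ∈ Icc a b, HasDerivWithinAt u (e • levelSlope p α β Φ (s, u s, e)) (Icc a b) s)
    (hmem : ∀ s ∈ Icc a b, u s ∈ J ∧ 0 < slowing p β Φ (s, u s, e))
    (hV : ∀ s ∈ Icc a b, Φ s (u s) ∈ V) :
    ∃ T ζ, IsArc (perturb X₀ p e) σ (0, σ * u a) (0, -(σ * u b)) T ζ ∧
      MapsTo ζ (Icc 0 T) V := by
  obtain ⟨θ, hθa, hθ⟩ := exists_timeChange
    (g := fun s => ω s (u s) / slowing p β Φ (s, u s, e)) hab.le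
    (fun s hs => by
      obtain ⟨hJ, hpos⟩ := hmem s hs
      have hcont := (hu s hs).continuousWithinAt
      exact ((h.continuousAt s _ hJ).comp_continuousWithinAt (f := fun s => (s, u s))
        (continuousWithinAt_id.prodMk hcont)).div
        ((h.contDiffAt_slowing hp hJ).continuousAt.comp_continuousWithinAt
          (f := fun s => (s, u s, e))
          (continuousWithinAt_id.prodMk (hcont.prodMk continuousWithinAt_const))) hpos.ne')
    fun s hs => div_pos (h.density_pos s _ (hmem s hs).1) (hmem s hs).2
  have hθb : θ (θ.symm b) = b := θ.apply_symm_apply b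
  have hmaps : MapsTo θ (Icc 0 (θ.symm b)) (Icc a b) := fun t ht =>
    ⟨hθa ▸ θ.monotone ht.1, hθb ▸ θ.monotone ht.2⟩
  refine ⟨θ.symm b, fun t => Φ (θ t) (u (θ t)), ⟨?_, ?_, ?_, fun t ht => ?_, fun t ht => ?_⟩,
    fun t ht => hV _ (hmaps ht)⟩
  · rwa [← θ.lt_iff_lt, hθa, hθb]
  · rw [hθa, h.source _ (hmem a (left_mem_Icc.2 hab.le)).1]
  · rw [hθb, h.target _ (hmem b (right_mem_Icc.2 hab.le)).1]
  · have hpos := hmem _ (hmaps ht)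
    have hderiv := (h.hasDerivWithinAt hpos.1 hpos.2 (hu _ (hmaps ht))).scomp t
      (hθ t (hmaps ht)).hasDerivWithinAt hmaps
    rwa [smul_smul, inv_mul_cancel₀ (div_pos (h.density_pos _ _ hpos.1) hpos.2).ne',
      one_smul] at hderiv
  · exact h.side _ ⟨hθa ▸ θ.strictMono ht.1, hθb ▸ θ.strictMono ht.2⟩ _
      (hmem _ (hmaps (Ioo_subset_Icc_self ht))).1

theorem isHalfMap (h : IsArcChart X₀ σ a b J α β ω Φ) (hab : a < b) (hp : ContDiff ℝ 1 p)
    (hJ : J ∈ 𝓝 r) {V : Set (ℝ × ℝ)} (hV : ∀ᶠ ρ in 𝓝 r, ∀ s ∈ Icc a b, Φ s ρ ∈ V) :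
    IsHalfMap (perturb X₀ p) σ r (fun ρ => ∫ s in a..b, α s * p (Φ s ρ)) V := by
  have hf : ∀ s ∈ Icc a b, ContDiffAt ℝ 1 (levelSlope p α β Φ) (s, r, 0) := fun s _ =>
    h.contDiffAt_levelSlope hp (mem_of_mem_nhds hJ) s
  obtain ⟨u, hu⟩ := exists_isSmallFlow hab.le hf
  refine ⟨displacement (levelSlope p α β Φ) u a b,
    hu.exists_hasStrictFDerivAt_displacement hab.le hf,
    (hu.displacement_zero_eventuallyEq hab.le).trans (.of_eq ?_), ?_⟩
  · simp [levelSlope, slowing]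
  have hmem := eventually_prod_principal_iff.1
    (hu.tendsto_prodMk.eventually (h.eventually_forall_mem hp hJ))
  have hmemV := eventually_prod_principal_iff.1 (hu.tendsto.eventually hV)
  filter_upwards [hu.initial, hu.hasDerivWithinAt, hu.eq_add_smul_displacement hf, hmem, hmemV]
    with z hza hdz hzb hz hzV
  have harc := h.exists_isArc hab hp hdz (fun s hs => hz s hs s hs) fun s hs => hzV s hs s hs
  rwa [hza, hzb b (right_mem_Icc.2 hab.le)] at harc

end IsArcChart

/-- Polar coordinates for the field `(-y, x)` on the left. -/
noncomputable def leftChart (s ρ : ℝ) : ℝ × ℝ := (ρ * Real.cos s, ρ * Real.sin s)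

/-- Coordinates for the field `(-y, 1 - x)` on the right: `ρ` labels the hyperbola
`(1 - x) ^ 2 - y ^ 2 = 1 - ρ ^ 2` and `s = y / ρ`. -/
noncomputable def rightChart (s ρ : ℝ) : ℝ × ℝ := (1 - √(1 - ρ ^ 2 + ρ ^ 2 * s ^ 2), ρ * s)

theorem isArcChart_leftChart :
    IsArcChart leftCenter 1 (Real.pi / 2) (3 * Real.pi / 2) (Ioi 0) Real.cos
      (fun s ρ => Real.sin s / ρ) (fun _ _ => 1) leftChart where
  source ρ _ := by simp [leftChart]
  target ρ _ := by
    have hangle : 3 * Real.pi / 2 = Real.pi / 2 + Real.pi := by ring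
    simp [leftChart, hangle, Real.cos_add_pi, Real.sin_add_pi]
  side s hs ρ hρ := by
    have hcos := Real.cos_neg_of_pi_div_two_lt_of_lt hs.1 (by linarith [hs.2])
    simpa [leftChart] using mul_neg_of_pos_of_neg hρ hcos
  contDiff_slope := Real.contDiff_cos
  contDiffAt_slowing_coeff s ρ hρ := by
    have hρ' : ρ ≠ 0 := ne_of_gt hρ
    fun_prop (disch := assumption)
  continuousAt _ _ _ := continuousAt_const
  density_pos _ _ _ := one_pos
  contDiffAt _ _ _ := by unfold leftChart; fun_prop
  deriv_fst s ρ _ := by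
    have hx := (Real.hasDerivAt_cos s).const_mul ρ
    have hy := (Real.hasDerivAt_sin s).const_mul ρ
    simpa [leftChart, leftCenter] using (hx.prodMk hy).deriv
  deriv_snd s ρ hρ := by
    have hρ' : ρ ≠ 0 := ne_of_gt hρ
    have hderiv : HasDerivAt (leftChart s) (Real.cos s, Real.sin s) ρ :=
      (hasDerivAt_mul_const _).prodMk (hasDerivAt_mul_const _)
    rw [hderiv.deriv]
    ext <;> simp only [leftChart, leftCenter, Prod.smul_mk, Prod.mk_add_mk, smul_eq_mul] <;>
      field_simp
    · linear_combination Real.sin_sq_add_cos_sq s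
    · ring

theorem one_sub_sq_add_sq_mul_sq_pos {ρ : ℝ} (hρ : ρ ∈ Ioo (0 : ℝ) 1) (s : ℝ) :
    0 < 1 - ρ ^ 2 + ρ ^ 2 * s ^ 2 := by
  have hsq : ρ ^ 2 < 1 := pow_lt_one₀ hρ.1.le hρ.2 two_ne_zero
  have hnonneg : 0 ≤ ρ ^ 2 * s ^ 2 := by positivity
  linarith

theorem deriv_rightChart_fst {ρ : ℝ} (hρ : ρ ∈ Ioo (0 : ℝ) 1) (s : ℝ) :
    deriv (fun s => rightChart s ρ) s =
      (ρ / √(1 - ρ ^ 2 + ρ ^ 2 * s ^ 2)) • rightSaddle (rightChart s ρ) := by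
  have hrad := one_sub_sq_add_sq_mul_sq_pos hρ s
  have hx := ((((hasDerivAt_id s).pow 2).const_mul (ρ ^ 2)).const_add (1 - ρ ^ 2)).sqrt hrad.ne'
  have hy := (hasDerivAt_id s).const_mul ρ
  refine ((hx.const_sub 1).prodMk hy).deriv.trans ?_
  have hw := (Real.sqrt_pos.2 hrad).ne'
  ext <;> simp only [rightChart, rightSaddle, Pi.pow_apply, id, Prod.smul_mk, smul_eq_mul] <;>
    field_simp
  · ring
  · ring

theorem deriv_rightChart_snd {ρ : ℝ} (hρ : ρ ∈ Ioo (0 : ℝ) 1) (s : ℝ) :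
    deriv (rightChart s) ρ = (ρ / √(1 - ρ ^ 2 + ρ ^ 2 * s ^ 2)) •
      ((1, 0) + (s / ρ) • rightSaddle (rightChart s ρ)) := by
  have hrad := one_sub_sq_add_sq_mul_sq_pos hρ s
  have hsq := (hasDerivAt_id ρ).pow 2
  have hx := ((hsq.const_sub 1).add (hsq.mul_const (s ^ 2))).sqrt hrad.ne'
  have hw := (Real.sqrt_pos.2 hrad).ne'
  have hρ' : ρ ≠ 0 := ne_of_gt hρ.1
  refine ((hx.const_sub 1).prodMk (hasDerivAt_mul_const s)).deriv.trans ?_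
  simp only [rightChart, rightSaddle, Pi.pow_apply, Pi.add_apply, id, Prod.smul_mk,
    Prod.mk_add_mk, smul_eq_mul, sub_sub_cancel]
  generalize √(1 - ρ ^ 2 + ρ ^ 2 * s ^ 2) = w at hw
  ext <;> field_simp <;> ring

theorem isArcChart_rightChart :
    IsArcChart rightSaddle (-1) (-1) 1 (Ioo 0 1) (fun _ => 1) (fun s ρ => s / ρ)
      (fun s ρ => ρ / √(1 - ρ ^ 2 + ρ ^ 2 * s ^ 2)) rightChart where
  source ρ _ := by simp [rightChart]
  target ρ _ := by simp [rightChart]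
  side s hs ρ hρ := by
    have hs' : s ^ 2 < 1 := by rw [sq_lt_one_iff_abs_lt_one, abs_lt]; exact hs
    have hsqrt : √(1 - ρ ^ 2 + ρ ^ 2 * s ^ 2) < 1 := by
      rw [Real.sqrt_lt' one_pos]
      nlinarith [pow_pos hρ.1 2]
    simpa [rightChart] using hsqrt
  contDiff_slope := contDiff_const
  contDiffAt_slowing_coeff s ρ hρ := by
    have hρ' : ρ ≠ 0 := ne_of_gt hρ.1
    fun_prop (disch := assumption)
  continuousAt s ρ hρ := by
    have hw := (Real.sqrt_pos.2 (one_sub_sq_add_sq_mul_sq_pos hρ s)).ne'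
    fun_prop (disch := assumption)
  density_pos s ρ hρ := div_pos hρ.1 (Real.sqrt_pos.2 (one_sub_sq_add_sq_mul_sq_pos hρ s))
  contDiffAt s ρ hρ := by
    have hrad : ContDiffAt ℝ 1 (fun z : ℝ × ℝ => 1 - z.2 ^ 2 + z.2 ^ 2 * z.1 ^ 2) (s, ρ) := by
      fun_prop
    exact (contDiffAt_const.sub (hrad.sqrt (one_sub_sq_add_sq_mul_sq_pos hρ s).ne')).prodMk
      (by fun_prop)
  deriv_fst s _ hρ := deriv_rightChart_fst hρ s
  deriv_snd s _ hρ := (one_smul ℝ _).trans (deriv_rightChart_snd hρ s)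

section FilippovSolutions

theorem absolutelyContinuousOnInterval_of_dist_le {E F : Type*} [PseudoMetricSpace E]
    [PseudoMetricSpace F] {f : ℝ → E} {g : ℝ → F} {a b : ℝ}
    (hf : AbsolutelyContinuousOnInterval f a b) (h : ∀ s t, dist (g s) (g t) ≤ dist (f s) (f t)) :
    AbsolutelyContinuousOnInterval g a b := by
  rw [absolutelyContinuousOnInterval_iff] at hf ⊢
  intro ε hε
  obtain ⟨δ, hδ, H⟩ := hf ε hε
  exact ⟨δ, hδ, fun I hI hlen => (Finset.sum_le_sum fun i _ => h _ _).trans_lt (H I hI hlen)⟩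

section NormedSpace

variable {E : Type*} [NormedAddCommGroup E] [NormedSpace ℝ E] {a b : ℝ}

theorem hasDerivWithinAt_Icc_of_ae_hasDerivAt [CompleteSpace E] {γ f : ℝ → E}
    (hγ : AbsolutelyContinuousOnInterval γ a b) (hf : Continuous f)
    (hae : ∀ᵐ t, t ∈ Ioo a b → HasDerivAt γ (f t) t) {t : ℝ} (ht : t ∈ Icc a b) :
    HasDerivWithinAt γ (f t) (Icc a b) t := by
  have hF : ∀ t, HasDerivAt (fun t => ∫ u in a..t, f u) (f t) t := fun t =>
    (hf.integral_hasStrictDerivAt a t).hasDerivAt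
  have hFcont : ContDiff ℝ 1 fun t => ∫ u in a..t, f u := by
    refine contDiff_one_iff_deriv.2 ⟨fun t => (hF t).differentiableAt, ?_⟩
    rwa [funext fun t => (hF t).deriv]
  obtain ⟨C, hC⟩ := (hγ.sub
    hFcont.contDiffOn.absolutelyContinuousOnInterval).const_of_ae_hasDerivAt_zero (by
      have hends : ∀ᵐ t : ℝ, t ∉ ({a, b} : Set ℝ) := (toFinite _).countable.ae_notMem volume
      filter_upwards [hae, hends] with t h hne ht'
      rw [mem_insert_iff, mem_singleton_iff, not_or] at hne
      rw [uIcc_of_le (ht.1.trans ht.2)] at ht'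
      simpa using (h ⟨ht'.1.lt_of_ne' hne.1, ht'.2.lt_of_ne hne.2⟩).sub (hF t))
  rw [uIcc_of_le (ht.1.trans ht.2)] at hC
  exact ((hF t).const_add C).hasDerivWithinAt.congr_of_mem
    (fun u hu => sub_eq_iff_eq_add.1 (hC u hu)) ht

theorem eqOn_Icc_of_hasDerivWithinAt [ProperSpace E] {X : E → E} (hX : ContDiff ℝ 1 X) {f g : ℝ → E}
    (hf : ∀ t ∈ Icc a b, HasDerivWithinAt f (X (f t)) (Icc a b) t)
    (hg : ∀ t ∈ Icc a b, HasDerivWithinAt g (X (g t)) (Icc a b) t) (ha : f a = g a) :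
    EqOn f g (Icc a b) := by
  have hfc : ContinuousOn f (Icc a b) := fun t ht => (hf t ht).continuousWithinAt
  have hgc : ContinuousOn g (Icc a b) := fun t ht => (hg t ht).continuousWithinAt
  obtain ⟨C, hC⟩ := isCompact_Icc.exists_bound_of_continuousOn (hfc.prodMk hgc)
  obtain ⟨K, hK⟩ := (hX.contDiffOn (s := Metric.closedBall 0 C)).exists_lipschitzOnWith
    one_ne_zero (convex_closedBall _ _) (isCompact_closedBall _ _)
  refine ODE_solution_unique_of_mem_Icc_right (v := fun _ => X)
    (s := fun _ => Metric.closedBall 0 C) (fun _ _ => hK) hfc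
    (fun t ht => (hf t (Ico_subset_Icc_self ht)).mono_of_mem_nhdsWithin (Icc_mem_nhdsGE_of_mem ht))
    (fun t ht => ?_) hgc
    (fun t ht => (hg t (Ico_subset_Icc_self ht)).mono_of_mem_nhdsWithin (Icc_mem_nhdsGE_of_mem ht))
    (fun t ht => ?_) ha
  · exact mem_closedBall_zero_iff.2 ((norm_fst_le (f t, g t)).trans (hC t (Ico_subset_Icc_self ht)))
  · exact mem_closedBall_zero_iff.2 ((norm_snd_le (f t, g t)).trans (hC t (Ico_subset_Icc_self ht)))

end NormedSpace

variable {R L : ℝ × ℝ → ℝ × ℝ} {γ : ℝ → ℝ × ℝ}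

theorem filippov_subset_segment (z : ℝ × ℝ) : filippov R L z ⊆ segment ℝ (L z) (R z) := by
  rintro v (⟨-, rfl⟩ | ⟨-, rfl⟩ | ⟨-, h⟩)
  exacts [right_mem_segment ℝ _ _, left_mem_segment ℝ _ _, h]

theorem filippov_of_neg {z : ℝ × ℝ} (hz : z.1 < 0) : filippov R L z = {L z} := by
  ext v
  simp [filippov, hz, hz.not_gt, hz.ne]

theorem filippov_of_pos {z : ℝ × ℝ} (hz : 0 < z.1) : filippov R L z = {R z} := by
  ext v
  simp [filippov, hz, hz.not_gt, hz.ne']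

theorem IsArc.hasDerivWithinAt_comp_sub {X : ℝ × ℝ → ℝ × ℝ} {σ T t₀ t : ℝ} {z₀ z₁ : ℝ × ℝ}
    {ζ : ℝ → ℝ × ℝ} (h : IsArc X σ z₀ z₁ T ζ) (ht : t ∈ Icc t₀ (t₀ + T)) :
    HasDerivWithinAt (fun t => ζ (t - t₀)) (X (ζ (t - t₀))) (Icc t₀ (t₀ + T)) t := by
  have hshift : MapsTo (fun u => u - t₀) (Icc t₀ (t₀ + T)) (Icc 0 T) := fun u hu =>
    ⟨sub_nonneg.2 hu.1, sub_le_iff_le_add'.2 hu.2⟩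
  have hderiv := (h.hasDerivWithinAt (t - t₀) (hshift ht)).scomp t
    ((hasDerivAt_id' t).sub_const t₀).hasDerivWithinAt hshift
  rwa [one_smul] at hderiv

namespace IsSolution

theorem continuous (h : IsSolution R L γ) : Continuous γ :=
  continuous_iff_continuousAt.2 fun t => (h.1 (t - 1) (t + 1)).continuousOn.continuousAt <| by
    rw [uIcc_of_le (by linarith)]
    exact Icc_mem_nhds (by linarith) (by linarith)

theorem hasDerivWithinAt (h : IsSolution R L γ) {X : ℝ × ℝ → ℝ × ℝ} (hX : Continuous X) {a b : ℝ}
    (hmem : ∀ t ∈ Ioo a b, filippov R L (γ t) ⊆ {X (γ t)}) :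
    ∀ t ∈ Icc a b, HasDerivWithinAt γ (X (γ t)) (Icc a b) t := by
  refine fun t ht => hasDerivWithinAt_Icc_of_ae_hasDerivAt (h.1 a b) (hX.comp h.continuous) ?_ ht
  filter_upwards [h.2] with u ⟨v, hv, hderiv⟩ hu
  rwa [Function.comp_apply, ← mem_singleton_iff.1 (hmem u hu hv)]

theorem mul_fst_lt_zero_of_crossing (h : IsSolution R L γ) (hR : Continuous R) (hL : Continuous L)
    {σ t₀ : ℝ} (h₀ : (γ t₀).1 = 0) (hRσ : σ * (R (γ t₀)).1 < 0) (hLσ : σ * (L (γ t₀)).1 < 0) :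
    ∀ᶠ t in 𝓝[>] t₀, σ * (γ t).1 < 0 := by
  obtain ⟨c, hc, hc₀⟩ := exists_between (max_lt hRσ hLσ)
  have hnear : ∀ᶠ t in 𝓝 t₀, σ * (R (γ t)).1 < c ∧ σ * (L (γ t)).1 < c :=
    (((hR.comp h.continuous).fst.const_mul σ).tendsto t₀ |>.eventually_lt_const
      ((le_max_left _ _).trans_lt hc)).and
    (((hL.comp h.continuous).fst.const_mul σ).tendsto t₀ |>.eventually_lt_const
      ((le_max_right _ _).trans_lt hc))
  obtain ⟨κ, hκ, hball⟩ := Metric.eventually_nhds_iff_ball.1 hnear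
  filter_upwards [Ioo_mem_nhdsGT (lt_add_of_pos_right t₀ hκ)] with t ht
  have hac : AbsolutelyContinuousOnInterval (fun u => σ * (γ u).1) t₀ t :=
    (absolutelyContinuousOnInterval_of_dist_le (h.1 t₀ t) fun _ _ => le_max_left _ _).const_mul σ
  have hslope : ∫ u in t₀..t, deriv (fun u => σ * (γ u).1) u ≤ ∫ _ in t₀..t, c := by
    refine intervalIntegral.integral_mono_ae_restrict ht.1.le hac.intervalIntegrable_deriv
      intervalIntegrable_const ((ae_restrict_iff' measurableSet_Icc).2 ?_)
    filter_upwards [h.2] with u ⟨v, hv, hderiv⟩ hu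
    have hlin : IsLinearMap ℝ fun v : ℝ × ℝ => σ * v.1 :=
      ⟨fun _ _ => mul_add _ _ _, fun _ _ => mul_left_comm _ _ _⟩
    obtain ⟨hru, hlu⟩ := hball u (by
      rw [Metric.mem_ball, Real.dist_eq, abs_of_nonneg (sub_nonneg.2 hu.1)]
      linarith [hu.2, ht.2])
    have hderiv' : HasDerivAt (fun u => σ * (γ u).1) (σ * v.1) u :=
      ((hasFDerivAt_fst (𝕜 := ℝ) (p := γ u)).comp_hasDerivAt u hderiv).const_mul σ
    rw [hderiv'.deriv]
    exact ((convex_halfSpace_lt hlin c).segment_subset hlu hru (filippov_subset_segment _ hv)).le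
  rw [hac.integral_deriv_eq_sub, h₀, mul_zero, sub_zero, intervalIntegral.integral_const] at hslope
  exact hslope.trans_lt (mul_neg_of_pos_of_neg (sub_pos.2 ht.1) hc₀)

theorem eqOn_arc (h : IsSolution R L γ) (hR : Continuous R) (hL : Continuous L)
    {X : ℝ × ℝ → ℝ × ℝ} (hX : ContDiff ℝ 1 X) {σ : ℝ}
    (hXσ : ∀ z : ℝ × ℝ, σ * z.1 < 0 → filippov R L z ⊆ {X z}) {z₀ z₁ : ℝ × ℝ} {T : ℝ}
    {ζ : ℝ → ℝ × ℝ} (hζ : IsArc X σ z₀ z₁ T ζ) {t₀ : ℝ} (ht₀ : γ t₀ = z₀) (h₀ : z₀.1 = 0)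
    (hRσ : σ * (R z₀).1 < 0) (hLσ : σ * (L z₀).1 < 0) :
    EqOn γ (fun t => ζ (t - t₀)) (Icc t₀ (t₀ + T)) := by
  have hderiv := fun t ht => hζ.hasDerivWithinAt_comp_sub (t₀ := t₀) (t := t) ht
  have hclosed : IsClosed ({t | γ t = ζ (t - t₀)} ∩ Icc t₀ (t₀ + T)) := by
    rw [inter_comm]
    exact (h.continuous.continuousOn.prodMk fun t ht => (hderiv t ht).continuousWithinAt)
      |>.preimage_isClosed_of_isClosed isClosed_Icc isClosed_diagonal
  refine hclosed.Icc_subset_of_forall_mem_nhdsWithin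
    (by simp [ht₀, hζ.source]) fun t ⟨heq, ht⟩ => ?_
  have hside : ∀ᶠ u in 𝓝[>] t, σ * (γ u).1 < 0 := by
    rcases ht.1.eq_or_lt with rfl | hlt
    · rw [← ht₀] at h₀ hRσ hLσ
      exact h.mul_fst_lt_zero_of_crossing hR hL h₀ hRσ hLσ
    · have hneg := hζ.side (t - t₀) ⟨by linarith, by linarith [ht.2]⟩
      rw [← heq] at hneg
      exact nhdsWithin_le_nhds
        ((h.continuous.fst.const_mul σ).tendsto t |>.eventually_lt_const hneg)
  obtain ⟨b, hb, hsub⟩ := (mem_nhdsGT_iff_exists_Ioo_subset' ht.2).1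
    (inter_mem hside (Ioo_mem_nhdsGT ht.2))
  have hbT : b ≤ t₀ + T := le_of_forall_lt fun c hc => by
    rcases le_or_gt c t with hct | hct
    · exact hct.trans_lt ht.2
    · exact (hsub ⟨hct, hc⟩).2.2
  have hIcc : Icc t b ⊆ Icc t₀ (t₀ + T) := Icc_subset_Icc ht.1 hbT
  refine mem_of_superset (Icc_mem_nhdsGT hb) (eqOn_Icc_of_hasDerivWithinAt hX
    (h.hasDerivWithinAt hX.continuous fun u hu => hXσ _ (hsub hu).1)
    (fun u hu => (hderiv u (hIcc hu)).mono hIcc) heq)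

end IsSolution

end FilippovSolutions

section PeriodicOrbits

theorem norm_sub_le_of_hasDerivAt_off_countable {E : Type*} [NormedAddCommGroup E] [NormedSpace ℝ E]
    [CompleteSpace E] {γ : ℝ → E} {s : Set ℝ} (hs : s.Countable) {a b C : ℝ} (hγ : Continuous γ)
    (h : ∀ t ∈ uIcc a b, t ∉ s → DifferentiableAt ℝ γ t ∧ ‖deriv γ t‖ ≤ C) :
    ‖γ b - γ a‖ ≤ C * |b - a| := by
  have hbound : ∀ᵐ t, t ∈ uIoc a b → ‖deriv γ t‖ ≤ C := by
    filter_upwards [hs.ae_notMem volume] with t hts ht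
    exact (h t (uIoc_subset_uIcc ht) hts).2
  have hint : IntervalIntegrable (deriv γ) volume a b := by
    refine (intervalIntegrable_const (c := C)).mono_fun
      (stronglyMeasurable_deriv γ).aestronglyMeasurable ?_
    filter_upwards [(ae_restrict_iff' measurableSet_uIoc).2 hbound] with t ht
    exact ht.trans (le_abs_self C)
  rw [← integral_eq_of_hasDerivAt_off_countable γ (deriv γ) hs hγ.continuousOn
    (fun t ht => (h t (Ioo_subset_Icc_self ht.1) ht.2).1.hasDerivAt) hint]
  exact intervalIntegral.norm_integral_le_of_norm_le_const_ae hbound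

theorem exists_periodic_extension {E : Type*} [TopologicalSpace E] {f : ℝ → E} {T : ℝ} (hT : 0 < T)
    (hf : ContinuousOn f (Icc 0 T)) (hends : f 0 = f T) :
    ∃ γ : ℝ → E, Continuous γ ∧ Function.Periodic γ T ∧ EqOn γ f (Icc 0 T) := by
  have : Fact (0 < T) := ⟨hT⟩
  have hper : Function.Periodic (fun t : ℝ => AddCircle.liftIco T 0 f t) T := fun t => by simp
  refine ⟨_, (AddCircle.liftIco_zero_continuous hends hf).comp (AddCircle.continuous_mk' T), hper,
    fun t ht => ?_⟩
  rcases ht.2.eq_or_lt with rfl | hlt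
  · exact hper.eq.trans ((AddCircle.liftIco_zero_coe_apply ⟨le_rfl, hT⟩).trans hends)
  · exact AddCircle.liftIco_zero_coe_apply ⟨ht.1, hlt⟩

variable {R L X : ℝ × ℝ → ℝ × ℝ} {γ ζ ζ₁ ζ₂ : ℝ → ℝ × ℝ} {σ T T₁ T₂ : ℝ} {z₀ z₁ : ℝ × ℝ}

theorem IsSolution.of_hasDerivAt_off_countable (hR : Continuous R) (hL : Continuous L)
    (hγ : Continuous γ) {s : Set ℝ} (hs : s.Countable)
    (h : ∀ t ∉ s, ∃ v ∈ filippov R L (γ t), HasDerivAt γ v t) : IsSolution R L γ := by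
  refine ⟨fun a b => ?_, (hs.ae_notMem volume).mono h⟩
  obtain ⟨C, hC⟩ := (isCompact_uIcc (a := a) (b := b)).exists_bound_of_continuousOn
    ((hL.comp hγ).prodMk (hR.comp hγ)).continuousOn
  lift C to NNReal using (norm_nonneg _).trans (hC a left_mem_uIcc)
  refine LipschitzOnWith.absolutelyContinuousOnInterval (K := C)
    (LipschitzOnWith.of_dist_le_mul fun x hx y hy => ?_)
  rw [dist_eq_norm, Real.dist_eq]
  refine norm_sub_le_of_hasDerivAt_off_countable hs hγ fun t ht hts => ?_
  obtain ⟨v, hv, hderiv⟩ := h t hts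
  have hbound := hC t (uIcc_subset_uIcc hy hx ht)
  have hball := (convex_closedBall (0 : ℝ × ℝ) C).segment_subset
    (mem_closedBall_zero_iff.2 ((norm_fst_le _).trans hbound))
    (mem_closedBall_zero_iff.2 ((norm_snd_le _).trans hbound))
  exact ⟨hderiv.differentiableAt, hderiv.deriv ▸
    mem_closedBall_zero_iff.1 (hball (filippov_subset_segment _ hv))⟩

namespace IsArc

theorem continuousOn (h : IsArc X σ z₀ z₁ T ζ) : ContinuousOn ζ (Icc 0 T) := fun t ht =>
  (h.hasDerivWithinAt t ht).continuousWithinAt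

theorem hasDerivAt_of_eqOn (h : IsArc X σ z₀ z₁ T ζ) {t₀ t : ℝ} (ht : t ∈ Ioo t₀ (t₀ + T))
    (heq : EqOn γ (fun t => ζ (t - t₀)) (Icc t₀ (t₀ + T))) : HasDerivAt γ (X (γ t)) t := by
  have ht' := Ioo_subset_Icc_self ht
  rw [heq ht']
  exact ((h.hasDerivWithinAt_comp_sub ht').congr_of_mem heq ht').hasDerivAt
    (Icc_mem_nhds ht.1 ht.2)

theorem exists_concat (h₁ : IsArc L 1 z₀ z₁ T₁ ζ₁) (h₂ : IsArc R (-1) z₁ z₀ T₂ ζ₂) :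
    ∃ f : ℝ → ℝ × ℝ, ContinuousOn f (Icc 0 (T₁ + T₂)) ∧ EqOn f ζ₁ (Icc 0 T₁) ∧
      EqOn f (fun t => ζ₂ (t - T₁)) (Icc T₁ (T₁ + T₂)) := by
  set f : ℝ → ℝ × ℝ := fun t => if t ≤ T₁ then ζ₁ t else ζ₂ (t - T₁)
  have hf₁ : EqOn f ζ₁ (Icc 0 T₁) := fun t ht => if_pos ht.2
  have hf₂ : EqOn f (fun t => ζ₂ (t - T₁)) (Icc T₁ (T₁ + T₂)) := fun t ht => by
    rcases ht.1.eq_or_lt with rfl | hlt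
    · simp [f, h₁.target, h₂.source]
    · exact if_neg hlt.not_ge
  refine ⟨f, ?_, hf₁, hf₂⟩
  rw [← Icc_union_Icc_eq_Icc h₁.pos.le (le_add_of_nonneg_right h₂.pos.le)]
  refine (h₁.continuousOn.congr hf₁).union_of_isClosed (ContinuousOn.congr ?_ hf₂)
    isClosed_Icc isClosed_Icc
  exact fun t ht => (h₂.hasDerivWithinAt_comp_sub ht).continuousWithinAt

theorem exists_periodic_isSolution (hR : Continuous R) (hL : Continuous L)
    (h₁ : IsArc L 1 z₀ z₁ T₁ ζ₁) (h₂ : IsArc R (-1) z₁ z₀ T₂ ζ₂) :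
    ∃ γ : ℝ → ℝ × ℝ, IsSolution R L γ ∧ Function.Periodic γ (T₁ + T₂) ∧ EqOn γ ζ₁ (Icc 0 T₁) ∧
      EqOn γ (fun t => ζ₂ (t - T₁)) (Icc T₁ (T₁ + T₂)) := by
  have hT₁ := h₁.pos
  have hT₂ := h₂.pos
  have hT := add_pos hT₁ hT₂
  obtain ⟨f, hf, hf₁, hf₂⟩ := h₁.exists_concat h₂
  have hends : f 0 = f (T₁ + T₂) := by
    rw [hf₁ ⟨le_rfl, hT₁.le⟩, hf₂ ⟨by linarith, le_rfl⟩]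
    simp [h₁.source, h₂.target]
  obtain ⟨γ, hγ, hper, heq⟩ := exists_periodic_extension hT hf hends
  have hγ₁ : EqOn γ ζ₁ (Icc 0 T₁) := (heq.mono (Icc_subset_Icc_right (by linarith))).trans hf₁
  have hγ₂ := (heq.mono (Icc_subset_Icc_left hT₁.le)).trans hf₂
  have hcount := (countable_range fun k : ℤ => k • (T₁ + T₂)).union
    (countable_range fun k : ℤ => T₁ + k • (T₁ + T₂))
  refine ⟨γ, .of_hasDerivAt_off_countable hR hL hγ hcount fun t ht => ?_, hper, hγ₁, hγ₂⟩
  set k := toIcoDiv hT 0 t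
  set u := t - k • (T₁ + T₂) with hu
  have hu' : u ∈ Ico 0 (T₁ + T₂) := by
    rw [hu, self_sub_toIcoDiv_zsmul]
    simpa only [zero_add] using toIcoMod_mem_Ico hT 0 t
  have hu₀ : u ≠ 0 := fun h => ht (Or.inl ⟨k, (sub_eq_zero.1 h).symm⟩)
  have huT : u ≠ T₁ := fun h => ht (Or.inr ⟨k, (sub_eq_iff_eq_add.1 h).symm⟩)
  suffices ∃ v ∈ filippov R L (γ u), HasDerivAt γ v u by
    obtain ⟨v, hv, hderiv⟩ := this
    refine ⟨v, hper.sub_zsmul_eq k ▸ hv, ?_⟩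
    simpa only [hper.sub_zsmul_eq] using hderiv.comp_sub_const t (k • (T₁ + T₂))
  rcases huT.lt_or_gt with hlt | hgt
  · have hmem : u ∈ Ioo 0 T₁ := ⟨hu'.1.lt_of_ne' hu₀, hlt⟩
    refine ⟨L (γ u), ?_, h₁.hasDerivAt_of_eqOn (t₀ := 0) (by simpa using hmem) (by simpa using hγ₁)⟩
    rw [filippov_of_neg (by simpa [hγ₁ (Ioo_subset_Icc_self hmem)] using h₁.side u hmem)]
    rfl
  · have hmem : u - T₁ ∈ Ioo 0 T₂ := ⟨sub_pos.2 hgt, sub_lt_iff_lt_add'.2 hu'.2⟩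
    refine ⟨R (γ u), ?_, h₂.hasDerivAt_of_eqOn ⟨hgt, hu'.2⟩ hγ₂⟩
    rw [filippov_of_pos (by simpa [hγ₂ ⟨hgt.le, hu'.2.le⟩] using h₂.side _ hmem)]
    rfl

end IsArc

end PeriodicOrbits

section HyperbolicReturns

theorem strictAntiOn_mul_snd {f v : ℝ → ℝ × ℝ} {σ a b : ℝ}
    (hf : ∀ t ∈ Icc a b, HasDerivWithinAt f (v t) (Icc a b) t)
    (hv : ∀ t ∈ Ioo a b, σ * (v t).2 < 0) : StrictAntiOn (fun t => σ * (f t).2) (Icc a b) := by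
  have hcont : ContinuousOn f (Icc a b) := fun t ht => (hf t ht).continuousWithinAt
  refine strictAntiOn_of_deriv_neg (convex_Icc a b) (hcont.snd.const_smul σ) fun t ht => ?_
  rw [interior_Icc] at ht
  have hderiv : HasDerivAt (fun t => σ * (f t).2) (σ * (v t).2) t :=
    ((hasFDerivAt_snd (𝕜 := ℝ) (p := f t)).comp_hasDerivAt t
      ((hf t (Ioo_subset_Icc_self ht)).hasDerivAt (Icc_mem_nhds ht.1 ht.2))).const_mul σ
  exact hderiv.deriv ▸ hv t ht

theorem mem_of_mapsTo_of_dist {α : Type*} [MetricSpace α] {P : α → α} {Y : Set α} {x₀ : α}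
    (hY : IsCompact Y) (hne : Y.Nonempty) (hP : MapsTo P Y Y)
    (h : (∀ x ∈ Y, x ≠ x₀ → dist (P x) x₀ < dist x x₀) ∨
      ∀ x ∈ Y, x ≠ x₀ → dist x x₀ < dist (P x) x₀) : x₀ ∈ Y := by
  have hcont : ContinuousOn (fun x => dist x x₀) Y := by fun_prop
  by_contra hx₀
  have hne₀ : ∀ x ∈ Y, x ≠ x₀ := fun x hx heq => hx₀ (heq ▸ hx)
  rcases h with h | h
  · obtain ⟨x, hx, hmin⟩ := hY.exists_isMinOn hne hcont
    exact (hmin (hP hx)).not_gt (h x hx (hne₀ x hx))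
  · obtain ⟨x, hx, hmax⟩ := hY.exists_isMaxOn hne hcont
    exact (hmax (hP hx)).not_gt (h x hx (hne₀ x hx))

theorem mapsTo_Ici_of_forall_add {α : Type*} {g : ℝ → α} {z : α} {S : Set α} {t₀ T : ℝ} (hT : 0 < T)
    (h : ∀ t, g t = z → g (t + T) = z ∧ MapsTo g (Icc t (t + T)) S) (h₀ : g t₀ = z) :
    MapsTo g (Ici t₀) S := by
  have hiter : ∀ n : ℕ, g (t₀ + n * T) = z := fun n => by
    induction n with
    | zero => simpa using h₀
    | succ n ih => simpa only [Nat.cast_succ, add_one_mul, add_assoc] using (h _ ih).1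
  intro t ht
  have hfloor := Nat.floor_le (div_nonneg (sub_nonneg.2 ht) hT.le)
  have hlt := Nat.lt_floor_add_one ((t - t₀) / T)
  rw [le_div_iff₀ hT] at hfloor
  rw [div_lt_iff₀ hT] at hlt
  exact (h _ (hiter ⌊(t - t₀) / T⌋₊)).2 ⟨by linarith, by linarith⟩

variable {R L X : ℝ × ℝ → ℝ × ℝ} {γ ζ ζ₁ ζ₂ : ℝ → ℝ × ℝ} {σ T T₁ T₂ : ℝ} {z z₀ z₁ : ℝ × ℝ}
  {I J : Set ℝ} {A B : ℝ → ℝ} {V : Set (ℝ × ℝ)} {ρ ρ₀ t₀ : ℝ}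

theorem IsArc.eq_source_or_eq_target (h : IsArc X σ z₀ z₁ T ζ) (hz : z ∈ ζ '' Icc 0 T)
    (h₀ : z.1 = 0) : z = z₀ ∨ z = z₁ := by
  obtain ⟨t, ht, rfl⟩ := hz
  rcases eq_endpoints_or_mem_Ioo_of_mem_Icc ht with rfl | rfl | ht
  · exact Or.inl h.source
  · exact Or.inr h.target
  · exact absurd (h.side t ht) (by simp [h₀])

/-- Solutions of the system `(R, L)` cross the line at `(0, σ ρ)`, `ρ ∈ I`, into the half plane
`σ x < 0`, where the field is `X`, and return to the line at `(0, -σ A(ρ))` along an arc in `V`.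
For `x < 1` the field `X` is monotone in the `y` direction, which makes the arcs simple. -/
structure IsHalfReturn (R L X : ℝ × ℝ → ℝ × ℝ) (σ : ℝ) (I : Set ℝ) (A : ℝ → ℝ)
    (V : Set (ℝ × ℝ)) : Prop where
  contDiff : ContDiff ℝ 1 X
  filippov_subset : ∀ z : ℝ × ℝ, σ * z.1 < 0 → filippov R L z ⊆ {X z}
  mul_snd_neg : ∀ z : ℝ × ℝ, σ * z.1 < 0 → z.1 < 1 → σ * (X z).2 < 0
  crossing_right : ∀ ρ ∈ I, σ * (R (0, σ * ρ)).1 < 0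
  crossing_left : ∀ ρ ∈ I, σ * (L (0, σ * ρ)).1 < 0
  exists_isArc : ∀ ρ ∈ I, ∃ T ζ,
    IsArc X σ (0, σ * ρ) (0, -(σ * A ρ)) T ζ ∧ MapsTo ζ (Icc 0 T) V

namespace IsHalfReturn

theorem mul_fst_pos (h : IsHalfReturn R L X σ I A V) (hρ : ρ ∈ I) :
    0 < (R (0, σ * ρ)).1 * (L (0, σ * ρ)).1 := by
  refine pos_of_mul_pos_right (a := σ * σ) ?_ (mul_self_nonneg σ)
  rw [mul_mul_mul_comm]
  exact mul_pos_of_neg_of_neg (h.crossing_right ρ hρ) (h.crossing_left ρ hρ)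

theorem injOn_arc (h : IsHalfReturn R L X σ I A V) (hV : V ⊆ {z | z.1 < 1})
    (hζ : IsArc X σ z₀ z₁ T ζ) (hmaps : MapsTo ζ (Icc 0 T) V) : InjOn ζ (Icc 0 T) :=
  InjOn.of_comp (g := fun z : ℝ × ℝ => σ * z.2)
    (strictAntiOn_mul_snd hζ.hasDerivWithinAt fun t ht => h.mul_snd_neg _ (hζ.side t ht)
      (hV (hmaps (Ioo_subset_Icc_self ht)))).injOn

theorem not_forall_side (h : IsHalfReturn R L X σ I A V) (hγ : IsSolution R L γ) (hT : 0 < T)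
    (hper : Function.Periodic γ T) (h₁ : ∀ t, (γ t).1 < 1) : ¬∀ t, σ * (γ t).1 < 0 := by
  intro hside
  have hanti := strictAntiOn_mul_snd (a := 0) (b := T)
    (hγ.hasDerivWithinAt h.contDiff.continuous fun t _ => h.filippov_subset _ (hside t))
    fun t _ => h.mul_snd_neg _ (hside t) (h₁ t)
  have hlt := hanti ⟨le_rfl, hT.le⟩ ⟨hT.le, le_rfl⟩ hT
  simp only [hper.eq, lt_self_iff_false] at hlt

theorem eqOn_arc (h : IsHalfReturn R L X σ I A V) (hR : Continuous R) (hL : Continuous L)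
    (hγ : IsSolution R L γ) (hρ : ρ ∈ I) (ht₀ : γ t₀ = (0, σ * ρ))
    (hζ : IsArc X σ (0, σ * ρ) z₁ T ζ) : EqOn γ (fun t => ζ (t - t₀)) (Icc t₀ (t₀ + T)) :=
  hγ.eqOn_arc hR hL h.contDiff h.filippov_subset hζ ht₀ rfl (h.crossing_right ρ hρ)
    (h.crossing_left ρ hρ)

theorem mem_range (h : IsHalfReturn R L X σ I A V) (hR : Continuous R) (hL : Continuous L)
    (hγ : IsSolution R L γ) (hρ : ρ ∈ I) (hmem : (0, σ * ρ) ∈ range γ) :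
    (0, -(σ * A ρ)) ∈ range γ := by
  obtain ⟨t₀, ht₀⟩ := hmem
  obtain ⟨T, ζ, hζ, -⟩ := h.exists_isArc ρ hρ
  refine ⟨t₀ + T, ?_⟩
  rw [h.eqOn_arc hR hL hγ hρ ht₀ hζ ⟨by linarith [hζ.pos], le_rfl⟩]
  simpa using hζ.target

end IsHalfReturn

/-- The points left of the saddle `(1, 0)` which, if on the line `x = 0`, have `y ∈ I` or
`-y ∈ J`. -/
def crossingWindow (I J : Set ℝ) : Set (ℝ × ℝ) :=
  {z | z.1 < 1 ∧ (z.1 ≠ 0 ∨ z.2 ∈ I ∨ -z.2 ∈ J)}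

theorem isOpen_crossingWindow (hI : IsOpen I) (hJ : IsOpen J) : IsOpen (crossingWindow I J) :=
  (isOpen_lt continuous_fst continuous_const).inter <|
    (isOpen_ne_fun continuous_fst continuous_const).union <|
      (hI.preimage continuous_snd).union (hJ.preimage continuous_snd.neg)

/-- The system `(R, L)` has the left half return map `A` on `I` and the right half return map `B`
on `J`, so that `B ∘ A` is its return map, and `ρ₀` is a fixed point of `B ∘ A` that is attracting
or repelling on `I`. -/
structure IsHyperbolicReturn (R L : ℝ × ℝ → ℝ × ℝ) (I J : Set ℝ) (A B : ℝ → ℝ) (V : Set (ℝ × ℝ))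
    (ρ₀ : ℝ) : Prop where
  left : IsHalfReturn R L L 1 I A V
  right : IsHalfReturn R L R (-1) J B V
  subset : V ⊆ {z | z.1 < 1}
  isOpen_left : IsOpen I
  isOpen_right : IsOpen J
  pos_left : I ⊆ Ioi 0
  pos_right : J ⊆ Ioi 0
  mapsTo : MapsTo A I J
  pos : ∀ ρ ∈ J, 0 < B ρ
  mem : ρ₀ ∈ I
  fixed : B (A ρ₀) = ρ₀
  dist_lt : (∀ ρ ∈ I, ρ ≠ ρ₀ → dist (B (A ρ)) ρ₀ < dist ρ ρ₀) ∨
    ∀ ρ ∈ I, ρ ≠ ρ₀ → dist ρ ρ₀ < dist (B (A ρ)) ρ₀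

namespace IsHyperbolicReturn

theorem continuous_left (h : IsHyperbolicReturn R L I J A B V ρ₀) : Continuous L :=
  h.left.contDiff.continuous

theorem continuous_right (h : IsHyperbolicReturn R L I J A B V ρ₀) : Continuous R :=
  h.right.contDiff.continuous

theorem exists_arcs (h : IsHyperbolicReturn R L I J A B V ρ₀) : ∃ T₁ ζ₁ T₂ ζ₂,
    IsArc L 1 (0, ρ₀) (0, -A ρ₀) T₁ ζ₁ ∧ MapsTo ζ₁ (Icc 0 T₁) V ∧
      IsArc R (-1) (0, -A ρ₀) (0, ρ₀) T₂ ζ₂ ∧ MapsTo ζ₂ (Icc 0 T₂) V := by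
  obtain ⟨T₁, ζ₁, h₁, hV₁⟩ := h.left.exists_isArc ρ₀ h.mem
  obtain ⟨T₂, ζ₂, h₂, hV₂⟩ := h.right.exists_isArc (A ρ₀) (h.mapsTo h.mem)
  rw [one_mul, one_mul] at h₁
  rw [neg_one_mul, neg_one_mul, neg_neg, h.fixed] at h₂
  exact ⟨T₁, ζ₁, T₂, ζ₂, h₁, hV₁, h₂, hV₂⟩

theorem image_eq (h : IsHyperbolicReturn R L I J A B V ρ₀) (hγ : IsSolution R L γ)
    (h₁ : IsArc L 1 (0, ρ₀) (0, -A ρ₀) T₁ ζ₁) (h₂ : IsArc R (-1) (0, -A ρ₀) (0, ρ₀) T₂ ζ₂)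
    (ht₀ : γ t₀ = (0, ρ₀)) : γ (t₀ + (T₁ + T₂)) = (0, ρ₀) ∧
      γ '' Icc t₀ (t₀ + (T₁ + T₂)) = ζ₁ '' Icc 0 T₁ ∪ ζ₂ '' Icc 0 T₂ := by
  have hT₁ := h₁.pos
  have hT₂ := h₂.pos
  have heq₁ := h.left.eqOn_arc h.continuous_right h.continuous_left hγ h.mem
    (by rwa [one_mul]) (by rwa [one_mul])
  have hmid : γ (t₀ + T₁) = (0, -A ρ₀) := by
    simpa [h₁.target] using heq₁ ⟨by linarith, le_rfl⟩
  have heq₂ := h.right.eqOn_arc h.continuous_right h.continuous_left hγ (h.mapsTo h.mem)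
    (by rwa [neg_one_mul]) (by rwa [neg_one_mul])
  rw [← add_assoc]
  constructor
  · simpa [h₂.target] using heq₂ ⟨by linarith, le_rfl⟩
  · rw [← Icc_union_Icc_eq_Icc (b := t₀ + T₁) (by linarith) (by linarith), image_union,
      heq₁.image_eq, heq₂.image_eq, ← image_image ζ₁, ← image_image ζ₂]
    simp

theorem range_eq (h : IsHyperbolicReturn R L I J A B V ρ₀) (hγ : IsSolution R L γ) (hT : 0 < T)
    (hper : Function.Periodic γ T) (h₁ : IsArc L 1 (0, ρ₀) (0, -A ρ₀) T₁ ζ₁)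
    (h₂ : IsArc R (-1) (0, -A ρ₀) (0, ρ₀) T₂ ζ₂) (hmem : (0, ρ₀) ∈ range γ) :
    range γ = ζ₁ '' Icc 0 T₁ ∪ ζ₂ '' Icc 0 T₂ := by
  obtain ⟨t₀, ht₀⟩ := hmem
  refine Subset.antisymm ?_ ?_
  · have hmaps := mapsTo_Ici_of_forall_add (add_pos h₁.pos h₂.pos)
      (fun t ht => ⟨(h.image_eq hγ h₁ h₂ ht).1, mapsTo_iff_image_subset.2
        (h.image_eq hγ h₁ h₂ ht).2.subset⟩) ht₀
    rw [← hper.image_Icc hT t₀]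
    exact (image_mono Icc_subset_Ici_self).trans hmaps.image_subset
  · exact (h.image_eq hγ h₁ h₂ ht₀).2 ▸ image_subset_range _ _

theorem exists_fst_eq_zero (h : IsHyperbolicReturn R L I J A B V ρ₀) (hγ : IsSolution R L γ)
    (hT : 0 < T) (hper : Function.Periodic γ T) (hlt : ∀ t, (γ t).1 < 1) : ∃ t, (γ t).1 = 0 := by
  obtain ⟨a, ha⟩ := not_forall.1 (h.left.not_forall_side hγ hT hper hlt)
  obtain ⟨b, hb⟩ := not_forall.1 (h.right.not_forall_side hγ hT hper hlt)
  exact mem_range_of_exists_le_of_exists_ge hγ.continuous.fst ⟨b, by linarith⟩ ⟨a, by linarith⟩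

theorem mem_range (h : IsHyperbolicReturn R L I J A B V ρ₀) (hγ : IsSolution R L γ) (hT : 0 < T)
    (hper : Function.Periodic γ T) (hsub : range γ ⊆ crossingWindow I J) : (0, ρ₀) ∈ range γ := by
  set Y := {ρ : ℝ | 0 ≤ ρ ∧ ((0 : ℝ), ρ) ∈ range γ}
  have hY : IsCompact Y := by
    have hrange : IsCompact (range γ) := by
      rw [← hper.image_Icc hT 0]
      exact isCompact_Icc.image hγ.continuous
    have himage : Y = Prod.snd '' (range γ ∩ {0} ×ˢ Ici 0) := by
      ext ρ
      simp [Y, and_comm]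
    exact himage ▸ (hrange.inter_right (isClosed_singleton.prod isClosed_Ici)).image continuous_snd
  have hleft : ∀ ρ ∈ I, ((0 : ℝ), ρ) ∈ range γ → (0, -A ρ) ∈ range γ := fun ρ hρ hmem => by
    simpa using h.left.mem_range h.continuous_right h.continuous_left hγ hρ (by simpa using hmem)
  have hright : ∀ ρ ∈ J, ((0 : ℝ), -ρ) ∈ range γ → B ρ ∈ Y := fun ρ hρ hmem => by
    refine ⟨(h.pos ρ hρ).le, ?_⟩
    simpa using h.right.mem_range h.continuous_right h.continuous_left hγ hρ (by simpa using hmem)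
  have hYI : Y ⊆ I := fun ρ ⟨hρ, hmem⟩ =>
    ((hsub hmem).2.resolve_left (absurd rfl)).resolve_right fun hJ =>
      (neg_nonpos.2 hρ).not_gt (h.pos_right hJ)
  have hmaps : MapsTo (B ∘ A) Y Y := fun ρ hρ =>
    hright _ (h.mapsTo (hYI hρ)) (hleft _ (hYI hρ) hρ.2)
  have hne : Y.Nonempty := by
    obtain ⟨t, ht⟩ := h.exists_fst_eq_zero hγ hT hper fun t => (hsub ⟨t, rfl⟩).1
    have hpt : γ t = (0, (γ t).2) := Prod.ext ht rfl
    rcases (hsub ⟨t, rfl⟩).2.resolve_left (not_not.2 ht) with hI | hJ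
    · exact ⟨_, (h.pos_left hI).le, t, hpt⟩
    · exact ⟨_, hright _ hJ ⟨t, by rwa [neg_neg]⟩⟩
  exact (mem_of_mapsTo_of_dist hY hne hmaps (h.dist_lt.imp
    (fun hlt ρ hρ => hlt ρ (hYI hρ)) fun hlt ρ hρ => hlt ρ (hYI hρ))).2

theorem injOn (h : IsHyperbolicReturn R L I J A B V ρ₀)
    (h₁ : IsArc L 1 (0, ρ₀) (0, -A ρ₀) T₁ ζ₁) (hV₁ : MapsTo ζ₁ (Icc 0 T₁) V)
    (h₂ : IsArc R (-1) (0, -A ρ₀) (0, ρ₀) T₂ ζ₂) (hV₂ : MapsTo ζ₂ (Icc 0 T₂) V)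
    (hγ₁ : EqOn γ ζ₁ (Icc 0 T₁)) (hγ₂ : EqOn γ (fun t => ζ₂ (t - T₁)) (Icc T₁ (T₁ + T₂))) :
    InjOn γ (Ico 0 (T₁ + T₂)) := by
  have hT₁ := h₁.pos
  have hT₂ := h₂.pos
  have hsub : ∀ t ∈ Ioo T₁ (T₁ + T₂), t - T₁ ∈ Ioo 0 T₂ := fun t ht =>
    ⟨sub_pos.2 ht.1, sub_lt_iff_lt_add'.2 ht.2⟩
  have hneg : ∀ t ∈ Icc 0 T₁, (ζ₁ t).1 ≤ 0 := fun t ht => by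
    rcases eq_endpoints_or_mem_Ioo_of_mem_Icc ht with rfl | rfl | ht
    · simp [h₁.source]
    · simp [h₁.target]
    · simpa using (h₁.side t ht).le
  rw [← Icc_union_Ioo_eq_Ico hT₁.le (by linarith), injOn_union
    (disjoint_left.2 fun t ht ht' => ht.2.not_gt ht'.1)]
  refine ⟨(h.left.injOn_arc h.subset h₁ hV₁).congr hγ₁.symm, fun s hs t ht hst => ?_,
    fun s hs t ht hst => ?_⟩
  · rw [hγ₂ (Ioo_subset_Icc_self hs), hγ₂ (Ioo_subset_Icc_self ht)] at hst
    exact sub_left_injective (h.right.injOn_arc h.subset h₂ hV₂ (Ioo_subset_Icc_self (hsub s hs))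
      (Ioo_subset_Icc_self (hsub t ht)) hst)
  · rw [hγ₁ hs, hγ₂ (Ioo_subset_Icc_self ht)] at hst
    have hpos := h₂.side _ (hsub t ht)
    linarith [hneg s hs, congrArg Prod.fst hst]

theorem exists_isLimitCycle (h : IsHyperbolicReturn R L I J A B V ρ₀) :
    ∃ Γ, IsLimitCycle R L Γ ∧ Γ ⊆ V ∧ (0, ρ₀) ∈ Γ := by
  obtain ⟨T₁, ζ₁, T₂, ζ₂, h₁, hV₁, h₂, hV₂⟩ := h.exists_arcs
  obtain ⟨γ, hγ, hper, hγ₁, hγ₂⟩ := h₁.exists_periodic_isSolution h.continuous_right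
    h.continuous_left h₂
  have hT := add_pos h₁.pos h₂.pos
  have hmem : (0, ρ₀) ∈ range γ := ⟨0, (hγ₁ ⟨le_rfl, h₁.pos.le⟩).trans h₁.source⟩
  have hrange := h.range_eq hγ hT hper h₁ h₂ hmem
  have hbottom : (0, -A ρ₀) ∈ range γ := hrange ▸ Or.inl ⟨T₁, ⟨h₁.pos.le, le_rfl⟩, h₁.target⟩
  have hline : ∀ z ∈ range γ, z.1 = 0 → z = (0, -A ρ₀) ∨ z = (0, ρ₀) := fun z hz h₀ => by
    rcases hrange ▸ hz with hz | hz
    · exact (h₁.eq_source_or_eq_target hz h₀).symm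
    · exact h₂.eq_source_or_eq_target hz h₀
  have hV : range γ ⊆ V := hrange ▸ union_subset hV₁.image_subset hV₂.image_subset
  refine ⟨range γ, ⟨⟨γ, _, hT, hγ, hper, h.injOn h₁ hV₁ h₂ hV₂ hγ₁ hγ₂, rfl⟩, ?_,
    ⟨-A ρ₀, ρ₀, neg_neg_iff_pos.2 (h.pos_right (h.mapsTo h.mem)), h.pos_left h.mem, ?_⟩,
    crossingWindow I J, isOpen_crossingWindow h.isOpen_left h.isOpen_right, ?_, ?_⟩, hV, hmem⟩
  · rintro z hz h₀
    rcases hline z hz h₀ with rfl | rfl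
    · simpa using h.right.mul_fst_pos (h.mapsTo h.mem)
    · simpa using h.left.mul_fst_pos h.mem
  · refine Subset.antisymm (fun z hz => hline z hz.1 hz.2) ?_
    rintro z (rfl | rfl)
    exacts [⟨hbottom, rfl⟩, ⟨hmem, rfl⟩]
  · refine fun z hz => ⟨h.subset (hV hz), or_iff_not_imp_left.2 fun h₀ => ?_⟩
    rcases hline z hz (not_not.1 h₀) with rfl | rfl
    · exact Or.inr (by simpa using h.mapsTo h.mem)
    · exact Or.inl h.mem
  · rintro _ ⟨g, T, hT', hg, hper', -, rfl⟩ hsub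
    rw [hrange, h.range_eq hg hT' hper' h₁ h₂ (h.mem_range hg hT' hper' hsub)]

end IsHyperbolicReturn

end HyperbolicReturns

section Displacement

variable {D : ℝ × ℝ → ℝ} {D' : ℝ × ℝ →L[ℝ] ℝ} {r : ℝ} {U : Set ℝ}

theorem exists_isOpen_eventually_forall {Q : ℝ × ℝ → Prop} (h : ∀ᶠ z in 𝓝 (r, 0), Q z) :
    ∃ W, IsOpen W ∧ r ∈ W ∧ ∀ᶠ e in 𝓝 0, ∀ ρ ∈ W, Q (ρ, e) := by
  rw [nhds_prod_eq] at h
  obtain ⟨P₁, h₁, P₂, h₂, hQ⟩ := eventually_prod_iff.1 h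
  obtain ⟨W, hW, hWo, hrW⟩ := eventually_nhds_iff.1 h₁
  exact ⟨W, hWo, hrW, h₂.mono fun e he ρ hρ => hQ (hW ρ hρ) he⟩

theorem apply_prodMk (D' : ℝ × ℝ →L[ℝ] ℝ) (x e : ℝ) : D' (x, e) = x * D' (1, 0) + D' (0, e) := by
  rw [← smul_eq_mul, ← map_smul, ← map_add]
  simp

theorem eventually_exists_eq_zero (hD : HasStrictFDerivAt D D' (r, 0)) (hzero : D (r, 0) = 0)
    (hsimple : D' (1, 0) ≠ 0) (hU : U ∈ 𝓝 r) : ∀ᶠ e in 𝓝 0, ∃ ρ ∈ U, D (ρ, e) = 0 := by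
  have hF : HasStrictFDerivAt (fun z => (D z, z.2)) (D'.prod (.snd ℝ ℝ ℝ)) (r, 0) :=
    hD.prodMk hasStrictFDerivAt_snd
  have hsurj : (D'.prod (.snd ℝ ℝ ℝ)).range = ⊤ :=
    LinearMap.range_eq_top.2 fun y => ⟨((y.1 - D' (0, y.2)) / D' (1, 0), y.2), by
      simp [apply_prodMk D' (_ / _), hsimple]⟩
  have hmem : {z : ℝ × ℝ | z.1 ∈ U} ∈ 𝓝 (r, (0 : ℝ)) := continuousAt_fst.preimage_mem_nhds hU
  have himage := image_mem_map (m := fun z => (D z, z.2)) hmem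
  rw [hF.map_nhds_eq_of_surj hsurj, hzero] at himage
  have haxis : ContinuousAt (fun e : ℝ => ((0 : ℝ), e)) 0 := by fun_prop
  filter_upwards [haxis.preimage_mem_nhds himage] with e ⟨z, hzU, hz⟩
  obtain ⟨hDz, rfl⟩ := Prod.mk.inj hz
  exact ⟨z.1, hzU, hDz⟩

theorem exists_eventually_pos_sub_mul_sub (hD : HasStrictFDerivAt D D' (r, 0))
    (hpos : 0 < D' (1, 0)) : ∃ W ∈ 𝓝 r, ∀ᶠ e in 𝓝 0, ∀ x ∈ W, ∀ y ∈ W, x ≠ y →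
      0 < (x - y) * (D (x, e) - D (y, e)) := by
  have hdiff := hD.isLittleO.bound (half_pos hpos)
  rw [nhds_prod_eq (x := (r, (0 : ℝ))), eventually_prod_self_iff'] at hdiff
  obtain ⟨t, ht, hdiff⟩ := hdiff
  obtain ⟨W, hW, hrW, hWt⟩ := exists_isOpen_eventually_forall ht
  refine ⟨W, hW.mem_nhds hrW, hWt.mono fun e he x hx y hy hxy => ?_⟩
  have hlin : D' (x - y, 0) = (x - y) * D' (1, 0) := by rw [apply_prodMk, ← Prod.zero_eq_mk]; simp
  have hbound := hdiff _ (he x hx) _ (he y hy)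
  rw [Prod.mk_sub_mk, sub_self, hlin, Prod.norm_def, norm_zero, max_eq_left (norm_nonneg _),
    Real.norm_eq_abs, Real.norm_eq_abs] at hbound
  have hscaled := mul_le_mul_of_nonneg_left hbound (abs_nonneg (x - y))
  rw [← abs_mul, mul_left_comm, abs_mul_abs_self] at hscaled
  have hgap := mul_pos (mul_self_pos.2 (sub_ne_zero.2 hxy)) hpos
  linarith [neg_le_of_abs_le hscaled]

theorem abs_lt_abs_add_of_mul_pos {x w : ℝ} (h : 0 < x * w) : |x| < |x + w| := by
  refine lt_of_mul_lt_mul_left ?_ (abs_nonneg x)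
  rw [abs_mul_abs_self, ← abs_mul, mul_add]
  exact (lt_add_of_pos_right _ h).trans_le (le_abs_self _)

theorem abs_add_lt_abs_of_mul_neg {x w : ℝ} (h : x * w < 0) (hpos : 0 < x * (x + w)) :
    |x + w| < |x| := by
  refine lt_of_mul_lt_mul_left ?_ (abs_nonneg x)
  rw [abs_mul_abs_self, ← abs_mul, abs_of_pos hpos, mul_add]
  exact add_lt_of_neg_right _ h

theorem hasStrictFDerivAt_add_snd_mul (hD : HasStrictFDerivAt D D' (r, 0)) :
    HasStrictFDerivAt (fun z : ℝ × ℝ => z.1 + z.2 * D z)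
      (.fst ℝ ℝ ℝ + ((0 : ℝ) • D' + D (r, 0) • .snd ℝ ℝ ℝ)) (r, 0) :=
  hasStrictFDerivAt_fst.add (hasStrictFDerivAt_snd.mul hD)

theorem tendsto_add_snd_mul (hD : HasStrictFDerivAt D D' (r, 0)) :
    Tendsto (fun z : ℝ × ℝ => z.1 + z.2 * D z) (𝓝 (r, 0)) (𝓝 r) := by
  simpa using (hasStrictFDerivAt_add_snd_mul hD).continuousAt.tendsto

theorem exists_eventually_dist_lt_or_lt (hD : HasStrictFDerivAt D D' (r, 0))
    (hsimple : D' (1, 0) ≠ 0) : ∃ W ∈ 𝓝 r, ∀ᶠ e in 𝓝[>] 0, ∀ ρ₀ ∈ W, D (ρ₀, e) = 0 →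
      (∀ ρ ∈ W, ρ ≠ ρ₀ → dist (ρ + e * D (ρ, e)) ρ₀ < dist ρ ρ₀) ∨
        ∀ ρ ∈ W, ρ ≠ ρ₀ → dist ρ ρ₀ < dist (ρ + e * D (ρ, e)) ρ₀ := by
  simp only [Real.dist_eq, add_sub_right_comm]
  rcases hsimple.lt_or_gt with hneg | hpos
  · obtain ⟨W₁, hW₁, hmono₁⟩ :=
      exists_eventually_pos_sub_mul_sub (hasStrictFDerivAt_add_snd_mul hD) (by simp)
    obtain ⟨W₂, hW₂, hmono₂⟩ :=
      exists_eventually_pos_sub_mul_sub hD.fun_neg (by simpa using hneg)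
    refine ⟨W₁ ∩ W₂, inter_mem hW₁ hW₂, ?_⟩
    filter_upwards [hmono₁.filter_mono nhdsWithin_le_nhds, hmono₂.filter_mono nhdsWithin_le_nhds,
      self_mem_nhdsWithin] with e h₁ h₂ he ρ₀ hρ₀ hzero
    refine Or.inl fun ρ hρ hne => abs_add_lt_abs_of_mul_neg ?_ ?_
    · rw [mul_left_comm]
      exact mul_neg_of_pos_of_neg he (by simpa [hzero] using h₂ ρ hρ.2 ρ₀ hρ₀.2 hne)
    · simpa [hzero, add_sub_right_comm] using h₁ ρ hρ.1 ρ₀ hρ₀.1 hne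
  · obtain ⟨W, hW, hmono⟩ := exists_eventually_pos_sub_mul_sub hD hpos
    refine ⟨W, hW, ?_⟩
    filter_upwards [hmono.filter_mono nhdsWithin_le_nhds, self_mem_nhdsWithin]
      with e h he ρ₀ hρ₀ hzero
    refine Or.inr fun ρ hρ hne => abs_lt_abs_add_of_mul_pos ?_
    rw [mul_left_comm]
    exact mul_pos he (by simpa [hzero] using h ρ hρ ρ₀ hρ₀ hne)

end Displacement

section Persistence

variable {p q : ℝ × ℝ → ℝ} {d₁ d₂ : ℝ × ℝ → ℝ} {r : ℝ} {V : Set (ℝ × ℝ)}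

/-- The displacement of the return map `ρ ↦ ρ + e D(ρ, e)` composed of two half maps with
displacements `d₁` and `d₂`. -/
def returnDisplacement (d₁ d₂ : ℝ × ℝ → ℝ) (z : ℝ × ℝ) : ℝ :=
  d₁ z + d₂ (z.1 + z.2 * d₁ z, z.2)

theorem exists_hasStrictFDerivAt_returnDisplacement {d₁' d₂' : ℝ × ℝ →L[ℝ] ℝ}
    (h₁ : HasStrictFDerivAt d₁ d₁' (r, 0)) (h₂ : HasStrictFDerivAt d₂ d₂' (r, 0)) :
    ∃ D' : ℝ × ℝ →L[ℝ] ℝ, HasStrictFDerivAt (returnDisplacement d₁ d₂) D' (r, 0) := by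
  have hmap := (hasStrictFDerivAt_add_snd_mul h₁).prodMk (hasStrictFDerivAt_snd (𝕜 := ℝ))
  have hpoint : (r + 0 * d₁ (r, 0), (0 : ℝ)) = (r, 0) := by simp
  rw [← hpoint] at h₂
  have hcomp : HasStrictFDerivAt (fun z : ℝ × ℝ => d₂ (z.1 + z.2 * d₁ z, z.2)) _ (r, 0) :=
    HasStrictFDerivAt.comp (r, 0) h₂ hmap
  exact ⟨_, h₁.add hcomp⟩

theorem apply_one_zero_eq_deriv {D : ℝ × ℝ → ℝ} {D' : ℝ × ℝ →L[ℝ] ℝ}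
    (h : HasStrictFDerivAt D D' (r, 0)) : D' (1, 0) = deriv (fun ρ => D (ρ, 0)) r :=
  (h.hasFDerivAt.comp_hasDerivAt r ((hasDerivAt_id r).prodMk (hasDerivAt_const r 0))).deriv.symm

theorem contDiff_perturb {X₀ : ℝ × ℝ → ℝ × ℝ} (hX : ContDiff ℝ 1 X₀) (hp : ContDiff ℝ 1 p) (e : ℝ) :
    ContDiff ℝ 1 (perturb X₀ p e) := by
  unfold perturb
  fun_prop

theorem eventually_crossing {X₀ : ℝ × ℝ → ℝ × ℝ} (hX : ∀ y, (X₀ (0, y)).1 = -y) {σ : ℝ}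
    (hσ : σ ≠ 0) (hp : Continuous p) (hr : 0 < r) :
    ∀ᶠ z in 𝓝 (r, 0), σ * (perturb X₀ p z.2 (0, σ * z.1)).1 < 0 := by
  have hcont : Continuous fun z : ℝ × ℝ => σ * (-(σ * z.1) + z.2 * p (0, σ * z.1)) := by fun_prop
  have hneg : σ * (-(σ * r) + 0 * p (0, σ * r)) < 0 := by
    linarith [mul_pos (mul_self_pos.2 hσ) hr]
  filter_upwards [hcont.continuousAt.eventually (gt_mem_nhds hneg)] with z hz
  simpa [perturb, hX] using hz

theorem exists_isHalfReturn {R L X : ℝ → ℝ × ℝ → ℝ × ℝ} {σ : ℝ} {d : ℝ × ℝ → ℝ}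
    (hX : ∀ e, ContDiff ℝ 1 (X e))
    (hfilippov : ∀ e z, σ * z.1 < 0 → filippov (R e) (L e) z ⊆ {X e z})
    (hsnd : ∀ e z, σ * z.1 < 0 → z.1 < 1 → σ * (X e z).2 < 0)
    (hR : ∀ᶠ z in 𝓝 (r, 0), σ * (R z.2 (0, σ * z.1)).1 < 0)
    (hL : ∀ᶠ z in 𝓝 (r, 0), σ * (L z.2 (0, σ * z.1)).1 < 0)
    (harc : ∀ᶠ z in 𝓝 (r, 0), ∃ T ζ,
      IsArc (X z.2) σ (0, σ * z.1) (0, -(σ * (z.1 + z.2 * d z))) T ζ ∧ MapsTo ζ (Icc 0 T) V)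
    {Q : ℝ × ℝ → Prop} (hQ : ∀ᶠ z in 𝓝 (r, 0), Q z) :
    ∃ I, IsOpen I ∧ r ∈ I ∧ ∀ᶠ e in 𝓝 0,
      IsHalfReturn (R e) (L e) (X e) σ I (fun ρ => ρ + e * d (ρ, e)) V ∧ ∀ ρ ∈ I, Q (ρ, e) := by
  obtain ⟨I, hI, hrI, h⟩ :=
    exists_isOpen_eventually_forall ((hR.and hL).and (harc.and hQ))
  refine ⟨I, hI, hrI, h.mono fun e he => ⟨?_, fun ρ hρ => (he ρ hρ).2.2⟩⟩
  exact
    { contDiff := hX e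
      filippov_subset := hfilippov e
      mul_snd_neg := hsnd e
      crossing_right ρ hρ := (he ρ hρ).1.1
      crossing_left ρ hρ := (he ρ hρ).1.2
      exists_isArc ρ hρ := (he ρ hρ).2.1 }

theorem exists_isHalfReturn_pair {d₁' d₂' : ℝ × ℝ →L[ℝ] ℝ} {W : Set ℝ} (hp : ContDiff ℝ 1 p)
    (hq : ContDiff ℝ 1 q) (hr : 0 < r) (hd₁ : HasStrictFDerivAt d₁ d₁' (r, 0))
    (hd₂ : HasStrictFDerivAt d₂ d₂' (r, 0))
    (harc₁ : ∀ᶠ z in 𝓝 (r, 0), ∃ T ζ, IsArc (perturb leftCenter q z.2) 1 (0, 1 * z.1)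
      (0, -(1 * (z.1 + z.2 * d₁ z))) T ζ ∧ MapsTo ζ (Icc 0 T) V)
    (harc₂ : ∀ᶠ z in 𝓝 (r, 0), ∃ T ζ, IsArc (perturb rightSaddle p z.2) (-1) (0, -1 * z.1)
      (0, -(-1 * (z.1 + z.2 * d₂ z))) T ζ ∧ MapsTo ζ (Icc 0 T) V) (hW : W ∈ 𝓝 r) :
    ∃ I J, IsOpen I ∧ r ∈ I ∧ IsOpen J ∧ ∀ᶠ e in 𝓝 0,
      (IsHalfReturn (perturb rightSaddle p e) (perturb leftCenter q e) (perturb leftCenter q e) 1 I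
        (fun ρ => ρ + e * d₁ (ρ, e)) V ∧ ∀ ρ ∈ I, ρ ∈ W ∧ 0 < ρ ∧ ρ + e * d₁ (ρ, e) ∈ J) ∧
      (IsHalfReturn (perturb rightSaddle p e) (perturb leftCenter q e) (perturb rightSaddle p e)
        (-1) J (fun ρ => ρ + e * d₂ (ρ, e)) V ∧ ∀ ρ ∈ J, 0 < ρ ∧ 0 < ρ + e * d₂ (ρ, e)) := by
  have hcross {σ : ℝ} (hσ : σ ≠ 0) :
      (∀ᶠ z in 𝓝 (r, 0), σ * (perturb rightSaddle p z.2 (0, σ * z.1)).1 < 0) ∧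
        ∀ᶠ z in 𝓝 (r, 0), σ * (perturb leftCenter q z.2 (0, σ * z.1)).1 < 0 :=
    ⟨eventually_crossing (fun _ => rfl) hσ hp.continuous hr,
      eventually_crossing (fun _ => rfl) hσ hq.continuous hr⟩
  have hpos : ∀ᶠ z in 𝓝 (r, (0 : ℝ)), 0 < z.1 := continuousAt_fst.eventually (lt_mem_nhds hr)
  have hmem : ∀ᶠ z in 𝓝 (r, (0 : ℝ)), z.1 ∈ W := continuousAt_fst.eventually hW
  obtain ⟨J, hJ, hrJ, hright⟩ := exists_isHalfReturn
    (contDiff_perturb (by unfold rightSaddle; fun_prop) hp)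
    (fun e z hz => (filippov_of_pos (by simpa using hz)).subset)
    (fun e z _ hz => by simpa [perturb, rightSaddle] using hz)
    (hcross (by norm_num)).1 (hcross (by norm_num)).2 harc₂
    (hpos.and ((tendsto_add_snd_mul hd₂).eventually (lt_mem_nhds hr)))
  obtain ⟨I, hI, hrI, hleft⟩ := exists_isHalfReturn
    (contDiff_perturb (by unfold leftCenter; fun_prop) hq)
    (fun e z hz => (filippov_of_neg (by simpa using hz)).subset)
    (fun e z hz _ => by simpa [perturb, leftCenter] using hz)
    (hcross one_ne_zero).1 (hcross one_ne_zero).2 harc₁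
    (hmem.and (hpos.and ((tendsto_add_snd_mul hd₁).eventually (hJ.mem_nhds hrJ))))
  exact ⟨I, J, hI, hrI, hJ, hleft.and hright⟩

theorem eventually_exists_isLimitCycle {I₁ I₂ : ℝ → ℝ} {U : Set ℝ} (hp : ContDiff ℝ 1 p)
    (hq : ContDiff ℝ 1 q) (hr : 0 < r) (hV : V ⊆ {z | z.1 < 1})
    (h₁ : IsHalfMap (perturb leftCenter q) 1 r I₁ V)
    (h₂ : IsHalfMap (perturb rightSaddle p) (-1) r I₂ V) (hzero : I₁ r + I₂ r = 0)
    (hsimple : deriv (fun ρ => I₁ ρ + I₂ ρ) r ≠ 0) (hU : U ∈ 𝓝 r) :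
    ∀ᶠ e in 𝓝[>] 0, ∃ ρ ∈ U, ∃ Γ,
      IsLimitCycle (perturb rightSaddle p e) (perturb leftCenter q e) Γ ∧ Γ ⊆ V ∧
        (0, ρ) ∈ Γ := by
  obtain ⟨d₁, ⟨d₁', hd₁⟩, hI₁, harc₁⟩ := h₁
  obtain ⟨d₂, ⟨d₂', hd₂⟩, hI₂, harc₂⟩ := h₂
  obtain ⟨D', hD⟩ := exists_hasStrictFDerivAt_returnDisplacement hd₁ hd₂
  have hD₀ : (fun ρ => returnDisplacement d₁ d₂ (ρ, 0)) =ᶠ[𝓝 r] fun ρ => I₁ ρ + I₂ ρ := by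
    filter_upwards [hI₁, hI₂] with ρ h₁ h₂
    simp [returnDisplacement, h₁, h₂]
  have hD₁ : D' (1, 0) ≠ 0 := by rwa [apply_one_zero_eq_deriv hD, hD₀.deriv_eq]
  obtain ⟨W, hW, hdist⟩ := exists_eventually_dist_lt_or_lt hD hD₁
  obtain ⟨I, J, hI, hrI, hJ, hreturn⟩ :=
    exists_isHalfReturn_pair hp hq hr hd₁ hd₂ harc₁ harc₂ (inter_mem hW hU)
  filter_upwards [hdist, hreturn.filter_mono nhdsWithin_le_nhds, (eventually_exists_eq_zero hD
    (hD₀.eq_of_nhds.trans hzero) hD₁ (hI.mem_nhds hrI)).filter_mono nhdsWithin_le_nhds]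
    with e hdist ⟨⟨hleft, hImem⟩, hright, hJmem⟩ ⟨ρ₀, hρ₀, hzero⟩
  have hreturn_eq : ∀ ρ, ρ + e * d₁ (ρ, e) + e * d₂ (ρ + e * d₁ (ρ, e), e) =
      ρ + e * returnDisplacement d₁ d₂ (ρ, e) := fun ρ => by
    rw [returnDisplacement, mul_add, add_assoc]
  have hyp : IsHyperbolicReturn _ _ I J _ _ V ρ₀ :=
    { left := hleft
      right := hright
      subset := hV
      isOpen_left := hI
      isOpen_right := hJ
      pos_left ρ hρ := (hImem ρ hρ).2.1
      pos_right ρ hρ := (hJmem ρ hρ).1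
      mapsTo ρ hρ := (hImem ρ hρ).2.2
      pos ρ hρ := (hJmem ρ hρ).2
      mem := hρ₀
      fixed := by rw [hreturn_eq, hzero, mul_zero, add_zero]
      dist_lt := by
        simp only [hreturn_eq]
        exact (hdist ρ₀ (hImem ρ₀ hρ₀).1.1 hzero).imp
          (fun h ρ hρ => h ρ (hImem ρ hρ).1.1) fun h ρ hρ => h ρ (hImem ρ hρ).1.1 }
  exact ⟨ρ₀, (hImem ρ₀ hρ₀).1.2, hyp.exists_isLimitCycle⟩

end Persistence

section SimpleZeros

theorem exists_interpolation_nodes {K α V : Type*} [Field K] [AddCommGroup V] [Module K V]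
    [FiniteDimensional K V] (M : V →ₗ[K] α → K) {J : Set α}
    (hM : ∀ c, (∀ x ∈ J, M c x = 0) → c = 0) {k : ℕ} (hk : k ≤ Module.finrank K V) :
    ∃ s : Finset α, ↑s ⊆ J ∧ s.card = k ∧ ∀ v : α → K, ∃ c, ∀ x ∈ s, M c x = v x := by
  classical
  induction k with
  | zero => exact ⟨∅, by simp, rfl, fun v => ⟨0, by simp⟩⟩
  | succ k ih =>
    obtain ⟨s, hsJ, hcard, hs⟩ := ih (Nat.le_of_succ_le hk)
    obtain ⟨c₀, hc₀, hne⟩ : ∃ c₀, (∀ x ∈ s, M c₀ x = 0) ∧ c₀ ≠ 0 := by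
      have hker : (LinearMap.funLeft K K ((↑) : s → α) ∘ₗ M).ker ≠ ⊥ :=
        LinearMap.ker_ne_bot_of_finrank_lt (by simpa [hcard] using hk)
      obtain ⟨c₀, hc₀, hne⟩ := Submodule.exists_mem_ne_zero_of_ne_bot hker
      exact ⟨c₀, fun x hx => congrFun (LinearMap.mem_ker.1 hc₀) ⟨x, hx⟩, hne⟩
    obtain ⟨x₀, hx₀, hx₀M⟩ : ∃ x₀ ∈ J, M c₀ x₀ ≠ 0 := by
      by_contra! hzero
      exact hne (hM c₀ hzero)
    have hx₀s : x₀ ∉ s := fun h => hx₀M (hc₀ x₀ h)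
    refine ⟨insert x₀ s, by simp [insert_subset_iff, hx₀, hsJ],
      by rw [Finset.card_insert_of_notMem hx₀s, hcard], fun v => ?_⟩
    obtain ⟨c, hc⟩ := hs v
    refine ⟨c + ((v x₀ - M c x₀) / M c₀ x₀) • c₀, fun x hx => ?_⟩
    rcases Finset.mem_insert.1 hx with rfl | hx
    · simp [hx₀M]
    · simp [hc₀ x hx, hc x hx]

theorem exists_regular_value {f : ℝ → ℝ} {s : Set ℝ} {u v : ℝ}
    (hf : ∀ x ∈ s, DifferentiableAt ℝ f x) (huv : u < v) :
    ∃ y ∈ Ioo u v, ∀ x ∈ s, f x = y → deriv f x ≠ 0 := by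
  have hnull : volume (f '' {x ∈ s | deriv f x = 0}) = 0 :=
    addHaar_image_eq_zero_of_det_fderivWithin_eq_zero volume
      (f' := fun x => ContinuousLinearMap.toSpanSingleton ℝ (deriv f x))
      (fun x hx => (hf x hx.1).hasDerivAt.hasFDerivAt.hasFDerivWithinAt)
      fun x hx => by simp [hx.2, ContinuousLinearMap.det]
  by_contra! hcrit
  refine (Measure.measure_Ioo_pos volume).2 huv |>.ne' (measure_mono_null (fun y hy => ?_) hnull)
  obtain ⟨x, hx, hxy, hderiv⟩ := hcrit y hy
  exact ⟨x, ⟨hx, hderiv⟩, hxy⟩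

theorem exists_strictMono_eq_of_alternating {f : ℝ → ℝ} {k : ℕ} {o : Fin (k + 1) → ℝ}
    (ho : StrictMono o) (hf : ∀ i : Fin k, ContinuousOn f (Icc (o i.castSucc) (o i.succ)))
    (halt : ∀ j, f (o j) = (-1) ^ (j : ℕ)) {y : ℝ} (hy : y ∈ Ioo (-1) 1) :
    ∃ r : Fin k → ℝ, StrictMono r ∧
      ∀ i, r i ∈ Ioo (o i.castSucc) (o i.succ) ∧ f (r i) = y := by
  have hroot : ∀ i : Fin k, ∃ x ∈ Ioo (o i.castSucc) (o i.succ), f x = y := fun i => by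
    have hle := (ho i.castSucc_lt_succ).le
    have hleft := halt i.castSucc
    have hright := halt i.succ
    rw [Fin.val_castSucc] at hleft
    rw [Fin.val_succ, pow_succ] at hright
    rcases neg_one_pow_eq_or ℝ (i : ℕ) with h | h <;> rw [h] at hleft hright
    · exact intermediate_value_Ioo' hle (hf i) (by simpa [hleft, hright] using hy)
    · exact intermediate_value_Ioo hle (hf i) (by simpa [hleft, hright] using hy)
  choose r hr hry using hroot
  refine ⟨r, fun i j hij => ?_, fun i => ⟨hr i, hry i⟩⟩
  have hle : o i.succ ≤ o j.castSucc := ho.monotone (Fin.succ_le_castSucc_iff.2 hij)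
  exact ((hr i).2.trans_le hle).trans (hr j).1

theorem exists_simple_zeros {V : Type*} [AddCommGroup V] [Module ℝ V] [FiniteDimensional ℝ V]
    (M : V →ₗ[ℝ] ℝ → ℝ) {J : Set ℝ} (hJ : J.OrdConnected) (hM : ∀ c, (∀ ρ ∈ J, M c ρ = 0) → c = 0)
    (hdiff : ∀ c, ∀ ρ ∈ J, DifferentiableAt ℝ (M c) ρ) {c₁ : V} (hone : ∀ ρ, M c₁ ρ = 1) {k : ℕ}
    (hk : k + 1 ≤ Module.finrank ℝ V) :
    ∃ (c : V) (r : Fin k → ℝ), Function.Injective r ∧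
      ∀ i, r i ∈ J ∧ M c (r i) = 0 ∧ deriv (M c) (r i) ≠ 0 := by
  obtain ⟨s, hsJ, hcard, hs⟩ := exists_interpolation_nodes M hM hk
  let o := s.orderEmbOfFin hcard
  have hos : ∀ j, o j ∈ s := s.orderEmbOfFin_mem hcard
  obtain ⟨c, hc⟩ := hs (Function.extend o (fun j => (-1) ^ (j : ℕ)) 0)
  have halt : ∀ j, M c (o j) = (-1) ^ (j : ℕ) := fun j => by
    rw [hc _ (hos j), o.injective.extend_apply]
  have hsub : ∀ i : Fin k, Icc (o i.castSucc) (o i.succ) ⊆ J := fun i =>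
    hJ.out (hsJ (hos _)) (hsJ (hos _))
  obtain ⟨y, hy, hreg⟩ := exists_regular_value (hdiff c) (neg_one_lt_zero.trans one_pos)
  obtain ⟨r, hr, hry⟩ := exists_strictMono_eq_of_alternating o.strictMono
    (fun i x hx => (hdiff c x (hsub i hx)).continuousAt.continuousWithinAt) halt hy
  have hMy : M (c - y • c₁) = fun ρ => M c ρ - y := by
    ext ρ
    simp [hone]
  have hrJ : ∀ i, r i ∈ J := fun i => hsub i (Ioo_subset_Icc_self (hry i).1)
  refine ⟨c - y • c₁, r, hr.injective, fun i => ⟨hrJ i, ?_, ?_⟩⟩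
  · rw [hMy]
    exact sub_eq_zero.2 (hry i).2
  · rw [hMy, deriv_sub_const]
    exact hreg _ (hrJ i) (hry i).2

end SimpleZeros

section Logarithm

open Polynomial

theorem derivative_ne_zero_of_isRoot {K : Type*} [Field K] [CharZero K] {b : K[X]} {x : K}
    (hb : b ≠ 0) (hx : b.IsRoot x) : derivative b ≠ 0 := fun h => by
  obtain ⟨c, rfl⟩ := natDegree_eq_zero.1 (derivative_eq_zero.1 h)
  simp_all

theorem eq_zero_of_one_sub_X_sq_mul_wronskian_eq_of_isCoprime {K : Type*} [Field K] [CharZero K]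
    {a b : K[X]} (hcop : IsCoprime a b) (h : (1 - X ^ 2) * wronskian b a = 2 * b ^ 2) : b = 0 := by
  by_contra hb
  have hroot : b.IsRoot 1 := by simpa using congrArg (eval 1) h
  have hprime : Prime (X - C (1 : K)) := prime_X_sub_C 1
  have ha : ¬X - C 1 ∣ a := fun hdvd =>
    hprime.not_isUnit (hcop.isUnit_of_dvd' hdvd (dvd_iff_isRoot.2 hroot))
  have hX : ¬X - C (1 : K) ∣ -(1 + X) := by
    rw [dvd_iff_isRoot]
    simp
  obtain ⟨b₁, hb₁⟩ := pow_rootMultiplicity_dvd b 1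
  obtain ⟨b₂, hb₂⟩ := dvd_iff_isRoot.2 hroot
  have hdvd : (X - C 1) ^ b.rootMultiplicity 1 ∣ -(1 + X) * (derivative b * a) := by
    refine ⟨b₁ * (-(1 + X) * derivative a - 2 * b₂), mul_left_cancel₀ hprime.ne_zero ?_⟩
    rw [map_one] at hb₁ hb₂ ⊢
    rw [wronskian] at h
    linear_combination -h + ((1 - X ^ 2) * derivative a - 2 * b) * hb₁ -
      2 * (X - 1) ^ b.rootMultiplicity 1 * b₁ * hb₂
  have hderiv : (X - C 1) ^ b.rootMultiplicity 1 ∣ derivative b :=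
    hprime.pow_dvd_of_dvd_mul_right _ ha (hprime.pow_dvd_of_dvd_mul_left _ hX hdvd)
  have hle := (le_rootMultiplicity_iff (derivative_ne_zero_of_isRoot hb hroot)).2 hderiv
  rw [derivative_rootMultiplicity_of_root hroot] at hle
  have hpos := (rootMultiplicity_pos hb).2 hroot
  lia

theorem eq_zero_of_one_sub_X_sq_mul_wronskian_eq {K : Type*} [Field K] [CharZero K] {a b : K[X]}
    (h : (1 - X ^ 2) * wronskian b a = 2 * b ^ 2) : b = 0 := by
  classical
  by_contra hb
  obtain ⟨g, a', b', hab, rfl, rfl⟩ : ∃ g a' b', IsCoprime a' b' ∧ a = g * a' ∧ b = g * b' :=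
    ⟨gcd a b, a / gcd a b, b / gcd a b, isCoprime_div_gcd_div_gcd hb,
      (EuclideanDomain.mul_div_cancel' (gcd_ne_zero_of_right hb) (gcd_dvd_left a b)).symm,
      (EuclideanDomain.mul_div_cancel' (gcd_ne_zero_of_right hb) (gcd_dvd_right a b)).symm⟩
  have hg : g ≠ 0 := left_ne_zero_of_mul hb
  refine right_ne_zero_of_mul hb (eq_zero_of_one_sub_X_sq_mul_wronskian_eq_of_isCoprime hab
    (mul_left_cancel₀ (pow_ne_zero 2 hg) ?_))
  simp only [wronskian, derivative_mul] at h ⊢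
  linear_combination h

theorem eq_zero_of_eval_eq_mul_log {u v : ℝ} (hu : -1 ≤ u) (huv : u < v) (hv : v ≤ 1) {a b : ℝ[X]}
    (h : ∀ x ∈ Ioo u v, a.eval x = b.eval x * (Real.log (1 + x) - Real.log (1 - x))) : b = 0 := by
  refine eq_zero_of_one_sub_X_sq_mul_wronskian_eq (a := a)
    (eq_of_infinite_eval_eq _ _ ((Ioo_infinite huv).mono fun x hx => ?_))
  have hadd : 1 + x ≠ 0 := by linarith [hx.1]
  have hsub : 1 - x ≠ 0 := by linarith [hx.2]
  have hlog : HasDerivAt (fun x : ℝ => Real.log (1 + x) - Real.log (1 - x))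
      (1 / (1 + x) - -1 / (1 - x)) x :=
    (((hasDerivAt_id' x).const_add 1).log hadd).sub (((hasDerivAt_id' x).const_sub 1).log hsub)
  have hderiv := ((a.hasDerivAt x).congr_of_eventuallyEq
    (eventuallyEq_of_mem (Ioo_mem_nhds hx.1 hx.2) fun y hy => (h y hy).symm)).unique
      ((b.hasDerivAt x).mul hlog)
  have hfrac : (1 - x ^ 2) * (1 / (1 + x) - -1 / (1 - x)) = 2 := by
    field_simp
    ring
  simp only [wronskian, mem_ofPred_eq, eval_mul, eval_sub, eval_one, eval_pow, eval_X, eval_ofNat]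
  rw [hderiv, h x hx]
  linear_combination b.eval x ^ 2 * hfrac

end Logarithm

section Perturbation

/-- The polynomial functions of degree at most `n` on the plane. -/
def polySpace (n : ℕ) : Submodule ℝ (ℝ × ℝ → ℝ) :=
  Submodule.span ℝ {f | ∃ i j, i + j ≤ n ∧ f = fun z => z.1 ^ i * z.2 ^ j}

theorem monomial_mem_polySpace {n i j : ℕ} (h : i + j ≤ n) :
    (fun z : ℝ × ℝ => z.1 ^ i * z.2 ^ j) ∈ polySpace n :=
  Submodule.subset_span ⟨i, j, h, rfl⟩

theorem polySpace_mono : Monotone polySpace := fun _ _ h =>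
  Submodule.span_mono fun _ ⟨i, j, hij, hf⟩ => ⟨i, j, hij.trans h, hf⟩

theorem mul_mem_polySpace {m n : ℕ} {f g : ℝ × ℝ → ℝ} (hf : f ∈ polySpace m)
    (hg : g ∈ polySpace n) : f * g ∈ polySpace (m + n) := by
  have h := Submodule.mul_mem_mul hf hg
  rw [polySpace, polySpace, Submodule.span_mul_span] at h
  refine Submodule.span_mono ?_ h
  rintro _ ⟨_, ⟨i, j, hij, rfl⟩, _, ⟨k, l, hkl, rfl⟩, rfl⟩
  refine ⟨i + k, j + l, by lia, ?_⟩
  ext z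
  simp only [Pi.mul_apply]
  ring

theorem pow_mem_polySpace {m : ℕ} {f : ℝ × ℝ → ℝ} (hf : f ∈ polySpace m) (k : ℕ) :
    f ^ k ∈ polySpace (m * k) := by
  induction k with
  | zero => simpa [Pi.one_def] using monomial_mem_polySpace (n := 0) (i := 0) (j := 0) le_rfl
  | succ k ih =>
    rw [pow_succ, mul_add, mul_one]
    exact mul_mem_polySpace ih hf

theorem exists_poly_eq_monomial {n i j : ℕ} (h : i + j ≤ n) :
    ∃ c, poly n c = fun z => z.1 ^ i * z.2 ^ j := by
  have hcoeff : ∀ ij : ℕ × ℕ, ij ≠ (i, j) →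
      (Pi.single i (Pi.single j 1) : ℕ → ℕ → ℝ) ij.1 ij.2 = 0 := fun ij hne => by
    by_cases hi : ij.1 = i
    · have hj : ij.2 ≠ j := fun hj => hne (Prod.ext hi hj)
      simp [hi, hj]
    · simp [hi]
  refine ⟨Pi.single i (Pi.single j 1), funext fun z => ?_⟩
  rw [poly, Finset.sum_eq_single_of_mem (i + j) (by simpa [Nat.lt_succ_iff] using h),
    Finset.sum_eq_single_of_mem (i, j) (by simp)]
  · simp
  · intro ij _ hne
    rw [hcoeff ij hne, zero_mul, zero_mul]
  · refine fun l _ hl => Finset.sum_eq_zero fun ij hij => ?_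
    have hne : ij ≠ (i, j) := by
      rintro rfl
      exact hl (Finset.HasAntidiagonal.mem_antidiagonal.1 hij).symm
    rw [hcoeff ij hne, zero_mul, zero_mul]

theorem exists_poly_eq {n : ℕ} {f : ℝ × ℝ → ℝ} (hf : f ∈ polySpace n) : ∃ c, poly n c = f := by
  induction hf using Submodule.span_induction with
  | mem f hf =>
    obtain ⟨i, j, hij, rfl⟩ := hf
    exact exists_poly_eq_monomial hij
  | zero => exact ⟨0, funext fun z => by simp [poly]⟩
  | add f g _ _ hf hg =>
    obtain ⟨c, rfl⟩ := hf
    obtain ⟨d, rfl⟩ := hg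
    exact ⟨c + d, funext fun z => by simp [poly, add_mul, Finset.sum_add_distrib]⟩
  | smul t f _ hf =>
    obtain ⟨c, rfl⟩ := hf
    exact ⟨t • c, funext fun z => by simp [poly, Finset.mul_sum, mul_assoc]⟩

/-- The perturbation `p⁻` used in the left half plane: a polynomial in `x` alone. -/
def leftPert {m : ℕ} (a : Fin m → ℝ) (z : ℝ × ℝ) : ℝ := ∑ i, a i * z.1 ^ (i : ℕ)

/-- The perturbation `p⁺` used in the right half plane: a polynomial in the first integral
`(1 - x)² - y²`, times `1 - x`. -/
def rightPert {m : ℕ} (b : Fin m → ℝ) (z : ℝ × ℝ) : ℝ :=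
  ∑ j, b j * ((1 - z.1) * ((1 - z.1) ^ 2 - z.2 ^ 2) ^ (j : ℕ))

theorem leftPert_mem_polySpace {n : ℕ} (a : Fin (n + 1) → ℝ) : leftPert a ∈ polySpace n := by
  have hsum : leftPert a = ∑ i, a i • fun z : ℝ × ℝ => z.1 ^ (i : ℕ) * z.2 ^ 0 := by
    ext z
    simp [leftPert]
  rw [hsum]
  exact Submodule.sum_mem _ fun i _ => Submodule.smul_mem _ _ (monomial_mem_polySpace (by lia))

theorem rightPert_mem_polySpace {n : ℕ} (b : Fin ((n + 1) / 2) → ℝ) :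
    rightPert b ∈ polySpace n := by
  have hx : (fun z : ℝ × ℝ => 1 - z.1) ∈ polySpace 1 := by
    simpa [Pi.sub_def] using Submodule.sub_mem _
      (monomial_mem_polySpace (n := 1) (i := 0) (j := 0) zero_le_one)
      (monomial_mem_polySpace (n := 1) (i := 1) (j := 0) le_rfl)
  have hH : (fun z : ℝ × ℝ => (1 - z.1) ^ 2 - z.2 ^ 2) ∈ polySpace 2 := by
    simpa [Pi.sub_def, Pi.pow_def] using Submodule.sub_mem _ (pow_mem_polySpace hx 2)
      (monomial_mem_polySpace (n := 2) (i := 0) (j := 2) le_rfl)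
  have hsum : rightPert b = ∑ j, b j • ((fun z : ℝ × ℝ => 1 - z.1) *
      (fun z : ℝ × ℝ => (1 - z.1) ^ 2 - z.2 ^ 2) ^ (j : ℕ)) := by
    ext z
    simp [rightPert]
  rw [hsum]
  exact Submodule.sum_mem _ fun j _ => Submodule.smul_mem _ _
    (polySpace_mono (by lia) (mul_mem_polySpace hx (pow_mem_polySpace hH j)))

end Perturbation

section Integrals

theorem integral_sqrt_const_add_sq {c : ℝ} (hc : 0 < c) (a b : ℝ) :
    ∫ y in a..b, √(c + y ^ 2) =
      (b * √(c + b ^ 2) + c * Real.log (b + √(c + b ^ 2))) / 2 -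
        (a * √(c + a ^ 2) + c * Real.log (a + √(c + a ^ 2))) / 2 := by
  refine intervalIntegral.integral_eq_sub_of_hasDerivAt
    (f := fun y => (y * √(c + y ^ 2) + c * Real.log (y + √(c + y ^ 2))) / 2) (fun y _ => ?_)
    (Continuous.intervalIntegrable (by fun_prop) _ _)
  have hpos : 0 < c + y ^ 2 := by positivity
  have hlog : 0 < y + √(c + y ^ 2) := by
    have habs : |y| < √(c + y ^ 2) := by
      rw [← Real.sqrt_sq_eq_abs]
      exact Real.sqrt_lt_sqrt (sq_nonneg y) (by linarith)
    linarith [neg_abs_le y]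
  have hsqrt : HasDerivAt (fun y => √(c + y ^ 2)) (2 * y / (2 * √(c + y ^ 2))) y := by
    simpa using ((hasDerivAt_pow 2 y).const_add c).sqrt hpos.ne'
  have hprim := (((hasDerivAt_id' y).fun_mul hsqrt).fun_add
    ((((hasDerivAt_id' y).fun_add hsqrt).log hlog.ne').const_mul c)).div_const 2
  refine hprim.congr_deriv ?_
  have hsq := Real.sq_sqrt hpos.le
  have hw := Real.sqrt_pos.2 hpos
  generalize √(c + y ^ 2) = w at *
  obtain rfl : c = w ^ 2 - y ^ 2 := by linarith
  field_simp
  ring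

/-- The integral of `√(1 - ρ² + ρ² s²)` over `[-1, 1]`, in closed form. -/
noncomputable def saddleIntegral (ρ : ℝ) : ℝ :=
  1 + (1 - ρ ^ 2) / (2 * ρ) * (Real.log (1 + ρ) - Real.log (1 - ρ))

theorem integral_sqrt_eq_saddleIntegral {ρ : ℝ} (hρ : ρ ∈ Ioo (0 : ℝ) 1) :
    ∫ s in (-1 : ℝ)..1, √(1 - ρ ^ 2 + ρ ^ 2 * s ^ 2) = saddleIntegral ρ := by
  have hρ₀ : ρ ≠ 0 := hρ.1.ne'
  have hc : 0 < 1 - ρ ^ 2 := by nlinarith [hρ.1, hρ.2]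
  have hsubst := intervalIntegral.integral_comp_mul_left (a := -1) (b := 1)
    (fun y => √(1 - ρ ^ 2 + y ^ 2)) hρ₀
  simp only [mul_pow, mul_neg_one, mul_one, integral_sqrt_const_add_sq hc, even_two.neg_pow,
    sub_add_cancel, Real.sqrt_one, smul_eq_mul] at hsubst
  rw [hsubst, saddleIntegral, add_comm 1 ρ, sub_eq_neg_add 1 ρ]
  field_simp
  ring

theorem differentiableAt_saddleIntegral {ρ : ℝ} (hρ : ρ ∈ Ioo (0 : ℝ) 1) :
    DifferentiableAt ℝ saddleIntegral ρ := by
  have hadd : 1 + ρ ≠ 0 := by linarith [hρ.1]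
  have hsub : 1 - ρ ≠ 0 := by linarith [hρ.2]
  have hmul : 2 * ρ ≠ 0 := by linarith [hρ.1]
  unfold saddleIntegral
  fun_prop (disch := assumption)

/-- The integral of `cos ^ (i + 1)` over the left half circle. -/
noncomputable def cosMoment (i : ℕ) : ℝ :=
  ∫ s in (Real.pi / 2)..(3 * Real.pi / 2), Real.cos s ^ (i + 1)

theorem cosMoment_ne_zero (i : ℕ) : cosMoment i ≠ 0 := by
  have hlt : Real.pi / 2 < 3 * Real.pi / 2 := by linarith [Real.pi_pos]
  have hpos : 0 < ∫ s in (Real.pi / 2)..(3 * Real.pi / 2), (-Real.cos s) ^ (i + 1) := by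
    refine intervalIntegral.intervalIntegral_pos_of_pos_on
      (Continuous.intervalIntegrable (by fun_prop) _ _) (fun s hs => ?_) hlt
    refine pow_pos (neg_pos.2 (Real.cos_neg_of_pi_div_two_lt_of_lt hs.1 ?_)) _
    linarith [hs.2]
  simp_rw [neg_pow (Real.cos _), intervalIntegral.integral_const_mul] at hpos
  exact right_ne_zero_of_mul hpos.ne'

theorem integral_leftPert {m : ℕ} (a : Fin m → ℝ) (ρ : ℝ) :
    ∫ s in (Real.pi / 2)..(3 * Real.pi / 2), Real.cos s * leftPert a (leftChart s ρ) =
      ∑ i, a i * cosMoment i * ρ ^ (i : ℕ) := by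
  simp only [leftPert, leftChart, Finset.mul_sum, cosMoment]
  rw [intervalIntegral.integral_finsetSum fun i _ =>
    Continuous.intervalIntegrable (by fun_prop) _ _]
  refine Finset.sum_congr rfl fun i _ => ?_
  rw [mul_right_comm, ← intervalIntegral.integral_const_mul]
  congr 1
  ext s
  ring

theorem integral_rightPert {m : ℕ} (b : Fin m → ℝ) {ρ : ℝ} (hρ : ρ ∈ Ioo (0 : ℝ) 1) :
    ∫ s in (-1 : ℝ)..1, rightPert b (rightChart s ρ) =
      ∑ j, b j * (1 - ρ ^ 2) ^ (j : ℕ) * saddleIntegral ρ := by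
  have hlevel : ∀ s : ℝ, rightPert b (rightChart s ρ) =
      (∑ j, b j * (1 - ρ ^ 2) ^ (j : ℕ)) * √(1 - ρ ^ 2 + ρ ^ 2 * s ^ 2) := fun s => by
    have hs := (one_sub_sq_add_sq_mul_sq_pos hρ s).le
    simp only [rightPert, rightChart, Finset.sum_mul, sub_sub_cancel, Real.sq_sqrt hs, mul_pow,
      add_sub_cancel_right]
    exact Finset.sum_congr rfl fun j _ => by ring
  simp_rw [hlevel]
  rw [intervalIntegral.integral_const_mul, integral_sqrt_eq_saddleIntegral hρ, Finset.sum_mul]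

end Integrals

section Melnikov

/-- The first order Melnikov function of the perturbations `leftPert` and `rightPert`, as a linear
function of their coefficients. -/
noncomputable def melnikov (m k : ℕ) : (Fin m ⊕ Fin k → ℝ) →ₗ[ℝ] ℝ → ℝ where
  toFun c ρ := ∑ i, c (.inl i) * cosMoment i * ρ ^ (i : ℕ) +
    ∑ j, c (.inr j) * (1 - ρ ^ 2) ^ (j : ℕ) * saddleIntegral ρ
  map_add' c d := by
    ext ρ
    simp only [Pi.add_apply, add_mul, Finset.sum_add_distrib]
    abel
  map_smul' t c := by
    ext ρ
    simp only [Pi.smul_apply, smul_eq_mul, RingHom.id_apply, mul_add, Finset.mul_sum, mul_assoc]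

theorem melnikov_apply {m k : ℕ} (c : Fin m ⊕ Fin k → ℝ) (ρ : ℝ) :
    melnikov m k c ρ = ∑ i, c (.inl i) * cosMoment i * ρ ^ (i : ℕ) +
      ∑ j, c (.inr j) * (1 - ρ ^ 2) ^ (j : ℕ) * saddleIntegral ρ := rfl

theorem melnikov_eq_integral_add_integral {m k : ℕ} (c : Fin m ⊕ Fin k → ℝ) {ρ : ℝ}
    (hρ : ρ ∈ Ioo (0 : ℝ) 1) :
    melnikov m k c ρ =
      (∫ s in (Real.pi / 2)..(3 * Real.pi / 2),
        Real.cos s * leftPert (fun i => c (.inl i)) (leftChart s ρ)) +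
      ∫ s in (-1 : ℝ)..1, rightPert (fun j => c (.inr j)) (rightChart s ρ) := by
  rw [melnikov_apply, integral_leftPert, integral_rightPert _ hρ]

theorem differentiableAt_melnikov {m k : ℕ} (c : Fin m ⊕ Fin k → ℝ) {ρ : ℝ}
    (hρ : ρ ∈ Ioo (0 : ℝ) 1) : DifferentiableAt ℝ (melnikov m k c) ρ := by
  have hsaddle := differentiableAt_saddleIntegral hρ
  simp only [melnikov, LinearMap.coe_mk, AddHom.coe_mk]
  fun_prop

theorem melnikov_single_inl_zero {m k : ℕ} (ρ : ℝ) :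
    melnikov (m + 1) k (Pi.single (.inl 0) (cosMoment 0)⁻¹) ρ = 1 := by
  rw [melnikov_apply, Finset.sum_eq_single 0] <;> simp +contextual [cosMoment_ne_zero]

open Polynomial

theorem eq_zero_of_sum_mul_X_pow_eq_zero {R : Type*} [Semiring R] {m : ℕ} {a : Fin m → R}
    (h : ∑ i, C (a i) * X ^ (i : ℕ) = (0 : R[X])) (i : Fin m) : a i = 0 := by
  simpa [finsetSum_coeff, coeff_C_mul, coeff_X_pow, Fin.val_inj] using
    congrArg (fun P : R[X] => P.coeff i) h

theorem eq_zero_of_forall_mem_Ioo_eval_eq_zero {a b : ℝ} (hab : a < b) {P : ℝ[X]}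
    (h : ∀ x ∈ Ioo a b, P.eval x = 0) : P = 0 :=
  eq_zero_of_infinite_isRoot P ((Ioo_infinite hab).mono h)

theorem eq_zero_of_eval_add_eval_mul_saddleIntegral {a b : ℝ} (ha : 0 ≤ a) (hab : a < b)
    (hb : b ≤ 1) {Q T : ℝ[X]}
    (h : ∀ ρ ∈ Ioo a b, Q.eval ρ + T.eval (1 - ρ ^ 2) * saddleIntegral ρ = 0) :
    Q = 0 ∧ T = 0 := by
  have hmul : T.comp (1 - X ^ 2) * (1 - X ^ 2) = 0 := by
    refine eq_zero_of_eval_eq_mul_log (a := -(2 * X * (Q + T.comp (1 - X ^ 2))))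
      (neg_one_lt_zero.le.trans ha) hab hb fun ρ hρ => ?_
    have hρ₀ : ρ ≠ 0 := (ha.trans_lt hρ.1).ne'
    have hzero := h ρ hρ
    rw [saddleIntegral] at hzero
    simp only [eval_neg, eval_mul, eval_ofNat, eval_X, eval_add, eval_comp, eval_sub, eval_one,
      eval_pow]
    field_simp at hzero
    linear_combination -hzero
  have hX : (1 - X ^ 2 : ℝ[X]) ≠ 0 := fun hX => by simpa using congrArg (eval 0) hX
  have hcomp : T.comp (1 - X ^ 2) = 0 := (mul_eq_zero.1 hmul).resolve_right hX
  have hT : T = 0 := by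
    refine eq_zero_of_forall_mem_Ioo_eval_eq_zero one_pos fun y hy => ?_
    simpa [eval_comp, Real.sq_sqrt (sub_nonneg.2 hy.2.le)] using congrArg (eval √(1 - y)) hcomp
  exact ⟨eq_zero_of_forall_mem_Ioo_eval_eq_zero hab (by simpa [hT] using h), hT⟩

theorem eq_zero_of_melnikov_eq_zero {m k : ℕ} {a b : ℝ} (ha : 0 ≤ a) (hab : a < b) (hb : b ≤ 1)
    {c : Fin m ⊕ Fin k → ℝ} (h : ∀ ρ ∈ Ioo a b, melnikov m k c ρ = 0) : c = 0 := by
  obtain ⟨hQ, hT⟩ := eq_zero_of_eval_add_eval_mul_saddleIntegral ha hab hb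
    (Q := ∑ i : Fin m, C (c (.inl i) * cosMoment i) * X ^ (i : ℕ))
    (T := ∑ j : Fin k, C (c (.inr j)) * X ^ (j : ℕ)) fun ρ hρ => by
      simpa [melnikov_apply, eval_finsetSum, Finset.sum_mul] using h ρ hρ
  funext x
  rcases x with i | j
  · exact (mul_eq_zero.1 (eq_zero_of_sum_mul_X_pow_eq_zero hQ i)).resolve_right
      (cosMoment_ne_zero i)
  · exact eq_zero_of_sum_mul_X_pow_eq_zero hT j

end Melnikov

section UnperturbedOrbit

/-- The closed orbit of the unperturbed system through `(0, ρ)`, for `0 < ρ < 1`; its limit cases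
are the equilibrium (`ρ = 0`) and the homoclinic loop (`ρ = 1`). -/
def unperturbedOrbit (ρ : ℝ) : Set (ℝ × ℝ) :=
  (fun s => leftChart s ρ) '' Icc (Real.pi / 2) (3 * Real.pi / 2) ∪
    (fun s => rightChart s ρ) '' Icc (-1) 1

theorem unperturbedOrbit_subset_iff {ρ : ℝ} {U : Set (ℝ × ℝ)} :
    unperturbedOrbit ρ ⊆ U ↔
      (∀ s ∈ Icc (Real.pi / 2) (3 * Real.pi / 2), leftChart s ρ ∈ U) ∧
        ∀ s ∈ Icc (-1) 1, rightChart s ρ ∈ U := by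
  rw [unperturbedOrbit, union_subset_iff, image_subset_iff, image_subset_iff]
  rfl

theorem unperturbedOrbit_zero_subset : unperturbedOrbit 0 ⊆ {(0, 0)} :=
  unperturbedOrbit_subset_iff.2 ⟨fun s _ => by simp [leftChart], fun s _ => by simp [rightChart]⟩

theorem leftChart_one_mem_homoclinicLoop {s : ℝ} (hs : s ∈ Icc (Real.pi / 2) (3 * Real.pi / 2)) :
    leftChart s 1 ∈ homoclinicLoop := by
  have hsum := Real.sin_sq_add_cos_sq s
  have hcos : Real.cos s ≤ 0 :=
    Real.cos_nonpos_of_pi_div_two_le_of_le hs.1 (by linarith [hs.2])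
  simp only [homoclinicLoop, leftChart, one_mul]
  rcases hcos.eq_or_lt with h | h
  · rw [h] at hsum ⊢
    exact .inl ⟨le_rfl, zero_le_one, by linarith⟩
  · exact .inr ⟨h, by linarith⟩

theorem rightChart_one_mem_homoclinicLoop {s : ℝ} (hs : s ∈ Icc (-1 : ℝ) 1) :
    rightChart s 1 ∈ homoclinicLoop := by
  have habs : |s| ≤ 1 := abs_le.2 hs
  have hchart : rightChart s 1 = (1 - |s|, s) := by simp [rightChart, Real.sqrt_sq_eq_abs]
  rw [hchart]
  exact .inl ⟨sub_nonneg.2 habs, sub_le_self 1 (abs_nonneg s), by simp⟩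

theorem unperturbedOrbit_one_subset_homoclinicLoop : unperturbedOrbit 1 ⊆ homoclinicLoop :=
  unperturbedOrbit_subset_iff.2
    ⟨fun _ => leftChart_one_mem_homoclinicLoop, fun _ => rightChart_one_mem_homoclinicLoop⟩

theorem unperturbedOrbit_subset_fst_lt_one {ρ : ℝ} (hρ : ρ ∈ Ioo (0 : ℝ) 1) :
    unperturbedOrbit ρ ⊆ {z | z.1 < 1} := by
  refine unperturbedOrbit_subset_iff.2 ⟨fun s _ => ?_, fun s _ => ?_⟩
  · exact (mul_le_of_le_one_right hρ.1.le (Real.cos_le_one s)).trans_lt hρ.2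
  · exact sub_lt_self 1 (Real.sqrt_pos.2 (one_sub_sq_add_sq_mul_sq_pos hρ s))

theorem eventually_unperturbedOrbit_subset {ρ₀ : ℝ} {U : Set (ℝ × ℝ)}
    (hU : U ∈ 𝓝ˢ (unperturbedOrbit ρ₀)) : ∀ᶠ ρ in 𝓝 ρ₀, unperturbedOrbit ρ ⊆ U := by
  have hchart : ∀ {Φ : ℝ → ℝ → ℝ × ℝ}, (Continuous fun z : ℝ × ℝ => Φ z.2 z.1) → ∀ {u v : ℝ},
      ((fun s => Φ s ρ₀) '' Icc u v ⊆ unperturbedOrbit ρ₀) →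
        ∀ᶠ ρ in 𝓝 ρ₀, ∀ s ∈ Icc u v, Φ s ρ ∈ U := fun hΦ _ _ hsub =>
    isCompact_Icc.eventually_forall_of_forall_eventually fun s hs =>
      hΦ.continuousAt.eventually (mem_nhdsSet_iff_forall.1 hU _ (hsub (mem_image_of_mem _ hs)))
  simp only [unperturbedOrbit_subset_iff]
  exact (hchart (by unfold leftChart; fun_prop) subset_union_left).and
    (hchart (by unfold rightChart; fun_prop) subset_union_right)

end UnperturbedOrbit

section Bifurcation

theorem eventually_exists_isLimitCycle_of_melnikov {m k : ℕ} {c : Fin m ⊕ Fin k → ℝ} {r : ℝ}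
    {U : Set (ℝ × ℝ)} {W : Set ℝ} (hr : r ∈ Ioo (0 : ℝ) 1) (hU : U ∈ 𝓝ˢ (unperturbedOrbit r))
    (hzero : melnikov m k c r = 0) (hsimple : deriv (melnikov m k c) r ≠ 0) (hW : W ∈ 𝓝 r) :
    ∀ᶠ e in 𝓝[>] 0, ∃ ρ ∈ W, ∃ Γ,
      IsLimitCycle (perturb rightSaddle (rightPert fun j => c (.inr j)) e)
        (perturb leftCenter (leftPert fun i => c (.inl i)) e) Γ ∧ Γ ⊆ U ∧ (0, ρ) ∈ Γ := by
  have hq : ContDiff ℝ 1 (leftPert fun i => c (.inl i)) := by unfold leftPert; fun_prop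
  have hp : ContDiff ℝ 1 (rightPert fun j => c (.inr j)) := by unfold rightPert; fun_prop
  have hV : ∀ᶠ ρ in 𝓝 r, unperturbedOrbit ρ ⊆ U ∩ {z | z.1 < 1} := by
    filter_upwards [eventually_unperturbedOrbit_subset hU, isOpen_Ioo.mem_nhds hr] with ρ hρU hρ
    exact subset_inter hρU (unperturbedOrbit_subset_fst_lt_one hρ)
  simp only [unperturbedOrbit_subset_iff, eventually_and] at hV
  have h₁ := isArcChart_leftChart.isHalfMap (by linarith [Real.pi_pos]) hq (Ioi_mem_nhds hr.1)
    hV.1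
  have h₂ := isArcChart_rightChart.isHalfMap (by norm_num) hp (isOpen_Ioo.mem_nhds hr) hV.2
  simp only [one_mul] at h₂
  have hI := eventuallyEq_of_mem (isOpen_Ioo.mem_nhds hr) fun ρ hρ =>
    melnikov_eq_integral_add_integral c hρ
  refine (eventually_exists_isLimitCycle hp hq hr.1 inter_subset_right h₁ h₂
    (hI.eq_of_nhds.symm.trans hzero) (hI.deriv_eq ▸ hsimple) hW).mono ?_
  exact fun e ⟨ρ, hρ, Γ, hΓ, hΓU, hρΓ⟩ => ⟨ρ, hρ, Γ, hΓ, hΓU.trans inter_subset_left, hρΓ⟩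

theorem exists_coeffs_eq_perturb {n : ℕ} {p q : ℝ × ℝ → ℝ} (hp : p ∈ polySpace n)
    (hq : q ∈ polySpace n) :
    ∃ c : Coeffs, rightField n c = perturb rightSaddle p ∧
      leftField n c = perturb leftCenter q := by
  obtain ⟨a, rfl⟩ := exists_poly_eq hp
  obtain ⟨b, rfl⟩ := exists_poly_eq hq
  have hzero : ∀ z, poly n 0 z = 0 := fun z => by simp [poly]
  refine ⟨⟨a, 0, b, 0⟩, ?_, ?_⟩ <;> ext ε z <;>
    simp [rightField, leftField, perturb, rightSaddle, leftCenter, hzero]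

theorem IsLimitCycle.eq_of_mem {R L : ℝ × ℝ → ℝ × ℝ} {Γ : Set (ℝ × ℝ)} (h : IsLimitCycle R L Γ)
    {ρ ρ' : ℝ} (hρ₀ : 0 < ρ) (hρ₀' : 0 < ρ') (hρ : (0, ρ) ∈ Γ) (hρ' : (0, ρ') ∈ Γ) : ρ = ρ' := by
  obtain ⟨-, -, ⟨y₁, y₂, hy₁, -, hΓ⟩, -⟩ := h
  have hupper : ∀ {y : ℝ}, 0 < y → (0, y) ∈ Γ → y = y₂ := fun {y} hy hyΓ => by
    have hmem : ((0 : ℝ), y) ∈ ({(0, y₁), (0, y₂)} : Set (ℝ × ℝ)) := hΓ ▸ ⟨hyΓ, rfl⟩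
    simpa [(hy₁.trans hy).ne'] using hmem
  rw [hupper hρ₀ hρ, hupper hρ₀' hρ']

theorem le_encard_of_isLimitCycle {R L : ℝ × ℝ → ℝ × ℝ} {U : Set (ℝ × ℝ)} {k : ℕ}
    {W : Fin k → Set ℝ} (hW : Pairwise (Function.onFun Disjoint W)) (hpos : ∀ i, W i ⊆ Ioi 0)
    (h : ∀ i, ∃ ρ ∈ W i, ∃ Γ, IsLimitCycle R L Γ ∧ Γ ⊆ U ∧ (0, ρ) ∈ Γ) :
    (k : ℕ∞) ≤ {Γ | IsLimitCycle R L Γ ∧ Γ ⊆ U}.encard := by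
  choose ρ hρ Γ hΓ hΓU hρΓ using h
  have hinj : Function.Injective Γ := fun i j hij => by
    have heq : ρ i = ρ j := (hΓ i).eq_of_mem (hpos i (hρ i)) (hpos j (hρ j)) (hρΓ i) (hij ▸ hρΓ j)
    exact hW.eq (not_disjoint_iff.2 ⟨ρ i, hρ i, heq ▸ hρ j⟩)
  calc (k : ℕ∞) = ENat.card (Fin k) := by simp
    _ ≤ (range Γ).encard := hinj.encard_range
    _ ≤ {Γ | IsLimitCycle R L Γ ∧ Γ ⊆ U}.encard :=
      encard_le_encard (range_subset_iff.2 fun i => ⟨hΓ i, hΓU i⟩)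

theorem exists_Ioo_forall_mem_nhdsSet {S U : Set (ℝ × ℝ)} {ρ₀ : ℝ} (hρ₀ : ρ₀ ∈ Icc (0 : ℝ) 1)
    (hS : unperturbedOrbit ρ₀ ⊆ S) (hU : U ∈ 𝓝ˢ S) :
    ∃ a b, 0 ≤ a ∧ a < b ∧ b ≤ 1 ∧ ∀ ρ ∈ Ioo a b, U ∈ 𝓝ˢ (unperturbedOrbit ρ) := by
  have hS' : unperturbedOrbit ρ₀ ⊆ interior U :=
    hS.trans (subset_interior_iff_mem_nhdsSet.2 hU)
  obtain ⟨u, v, hmem, huv⟩ := mem_nhds_iff_exists_Ioo_subset.1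
    (eventually_unperturbedOrbit_subset (isOpen_interior.mem_nhdsSet.2 hS'))
  refine ⟨max u 0, min v 1, le_max_right u 0, ?_, min_le_right v 1, fun ρ hρ => ?_⟩
  · exact max_lt (lt_min (hmem.1.trans hmem.2) (hmem.1.trans_le hρ₀.2))
      (lt_min (hρ₀.1.trans_lt hmem.2) one_pos)
  · exact subset_interior_iff_mem_nhdsSet.1
      (huv ⟨(le_max_left u 0).trans_lt hρ.1, hρ.2.trans_le (min_le_left v 1)⟩)

theorem canBifurcate_of_unperturbedOrbit_subset (n : ℕ) {S : Set (ℝ × ℝ)} {ρ₀ : ℝ}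
    (hρ₀ : ρ₀ ∈ Icc (0 : ℝ) 1) (hS : unperturbedOrbit ρ₀ ⊆ S) :
    CanBifurcate n S (n + (n + 1) / 2) := by
  intro U hU
  obtain ⟨a, b, ha, hab, hb, hnhds⟩ := exists_Ioo_forall_mem_nhdsSet hρ₀ hS hU
  have hJ : ∀ ρ ∈ Ioo a b, ρ ∈ Ioo (0 : ℝ) 1 := fun ρ hρ =>
    ⟨ha.trans_lt hρ.1, hρ.2.trans_le hb⟩
  obtain ⟨c, r, hinj, hr⟩ := exists_simple_zeros (k := n + (n + 1) / 2)
    (melnikov (n + 1) ((n + 1) / 2)) ordConnected_Ioo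
    (fun c hc => eq_zero_of_melnikov_eq_zero ha hab hb hc)
    (fun c ρ hρ => differentiableAt_melnikov c (hJ ρ hρ)) melnikov_single_inl_zero (by simp)
  obtain ⟨W, hWr, hWdisj⟩ :=
    (pairwise_disjoint_nhds.comp_of_injective hinj).exists_mem_filter_of_disjoint
  obtain ⟨d, hdR, hdL⟩ := exists_coeffs_eq_perturb (rightPert_mem_polySpace fun j => c (.inr j))
    (leftPert_mem_polySpace fun i => c (.inl i))
  have hev := eventually_all.2 fun i => eventually_exists_isLimitCycle_of_melnikov
    (hJ _ (hr i).1) (hnhds _ (hr i).1) (hr i).2.1 (hr i).2.2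
    (inter_mem (hWr i) (Ioi_mem_nhds (hJ _ (hr i).1).1))
  obtain ⟨ε₀, hε₀, hsub⟩ := mem_nhdsGT_iff_exists_Ioo_subset.1 hev
  refine ⟨d, ε₀, hε₀, fun ε hε => ?_⟩
  rw [limitCyclesIn, hdR, hdL]
  exact le_encard_of_isLimitCycle
    (fun i j hij => (hWdisj hij).mono inter_subset_left inter_subset_left)
    (fun i => inter_subset_right) (hsub hε)

end Bifurcation

end PiecewiseHam

theorem theorem1p1 (n : ℕ) (hn : 1 ≤ n) :
    ((n + (n + 1) / 2 : ℕ) : ℕ∞) ≤ PiecewiseHam.NHopf n ∧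
      ((n + (n + 1) / 2 : ℕ) : ℕ∞) ≤ PiecewiseHam.NHomoc n :=
  ⟨le_iSup₂_of_le _ (PiecewiseHam.canBifurcate_of_unperturbedOrbit_subset n
      (Set.left_mem_Icc.2 zero_le_one) PiecewiseHam.unperturbedOrbit_zero_subset) le_rfl,
    le_iSup₂_of_le _ (PiecewiseHam.canBifurcate_of_unperturbedOrbit_subset n
      (Set.right_mem_Icc.2 zero_le_one) PiecewiseHam.unperturbedOrbit_one_subset_homoclinicLoop)
      le_rfl⟩
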